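/- **Setting.** There are $n\ge 1$ agents and $n$ rooms, real valuations $v_{ij}$ (of agent $i$ for room $j$), real budgets $b_{ij}$ (the most that agent $i$ can pay for room $j$) and a real total rent $R_t$. An allocation $(\sigma,r)$ consists of a bijection $\sigma$ from agents to rooms and a rent vector $r\in\mathbb R^n$ with $\sum_j r_j=R_t$. It is *envy-free* if $v_{i\sigma(i)}-r_{\sigma(i)}\ge v_{ij}-r_j$ for all agents $i$ and rooms $j$, and it *respects the budgets* if $r_{\sigma(i)}\le b_{i\sigma(i)}$ for all $i$. Let $EF_b(R_t)$ be the set of envy-free allocations of total rent $R_t$ that respect the budgets. For an assignment and rents, the *envy graph* has an edge from room $a$ to room $c$ if the occupant of $a$ weakly prefers $c$ to $a$ at these rents (a strong edge if it strictly prefers $c$, a weak one if it is indifferent); the *budget-aware envy graph* keeps the edge only if, moreover, $r_c$ is strictly below the occupant's budget for $c$. For a set $X$ of rooms, $R(X)$ and $R^{-1}(X)$ are the sets of rooms that are reachable from $X$, respectively that can reach $X$, in the envy graph (both contain $X$). **Algorithm BudgetAware-EF.** 1. Compute an envy-free allocation $(\sigma,r^0)$ of some total rent with Klijn's algorithm: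 from an arbitrary allocation, while there is a strong edge: if some strong edge lies on a cycle of the envy graph, move the agents along such a cycle; otherwise choose a strong edge $i\to j$, decrease the rents of $R^{-1}(\{i\})$ and increase those of $R(\{j\})$ at constant rates with constant total rent until a weak edge appears. 2. For each strongly connected component $C$ of the envy graph of $(\sigma,r^0)$, compute an assignment $\mu_C$ of the occupants of $C$ to the rooms of $C$ (maximum-rent computation): start with $\sigma$ and $r^0$ restricted to $C$, with the rents shifted by a common amount so that all budgets are respected, one of them with equality. Call an agent tight if its rent equals its budget. While every tight agent lies on a cycle of the budget-aware envy graph on $C$: if there is no tight agent, raise all rents of $C$ by the smallest slack $b_{i\sigma(i)}-r_{\sigma(i)}$; otherwise move the agents along a cycle through a tight agent. 3. Combine the $\mu_C$ into an assignment $\mu$, and shift $r^0$ by a constant to rents $r$ of total $R_t$, so that $(\mu,r)$ is envy-free. 4. Run the bounds algorithm on $(\mu,r)$ with upper bounds $u_j=b_{\mu^{-1}(j)j}$ and no lower bounds: with $U=\{j: r_j>u_j\}$ and $U_f=\{j: r_j=u_j\}$, while $U\ne\varnothing$, decrease the rents of $R^{-1}(U)$ and increase those of all rooms outside $R^{-1}(U\cup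 U_f)$ at constant rates with constant total rent, until a weak edge appears or a rent reaches its bound; if there is no room whose rent can be increased, report "no solution". Return $\mu$ and the final rents. **Theorem.** Algorithm BudgetAware-EF terminates and runs in polynomial time: there is a polynomial $P$ such that on every instance with $n$ agents it takes at most $P(n)$ steps, where arithmetic operations and comparisons of real numbers, operations on indices and Booleans, and array accesses have unit cost. If $EF_b(R_t)\neq\varnothing$, it returns an allocation in $EF_b(R_t)$; otherwise it reports "no solution". -/

import Mathlib

noncomputable section

namespace RentDivision

/-! ### Rent division with agent-room-specific budgets -/

/-- Agents and rooms are both numbered `0, …, n - 1`. -/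
abbrev Agent (n : ℕ) := Fin n

/-- See `Agent`. -/
abbrev Room (n : ℕ) := Fin n

/-- An allocation: an assignment of agents to rooms, and a rent for every room. -/
abbrev Allocation (n : ℕ) := (Agent n ≃ Room n) × (Room n → ℝ)

/-- `EF V Rt`: the envy-free allocations with total rent `Rt`, for the quasi-linear utilities
`u i j = V i j - r j`. -/
def EF {n : ℕ} (V : Agent n → Room n → ℝ) (Rt : ℝ) : Set (Allocation n) :=
  {p | ∑ j, p.2 j = Rt ∧ ∀ i j, V i j - p.2 j ≤ V i (p.1 i) - p.2 (p.1 i)}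

/-- `EFb V b Rt`: the envy-free allocations with total rent `Rt` in which no agent pays more than
its budget `b i j` for the room `j` that it gets. -/
def EFb {n : ℕ} (V b : Agent n → Room n → ℝ) (Rt : ℝ) : Set (Allocation n) :=
  {p | p ∈ EF V Rt ∧ ∀ i, p.2 (p.1 i) ≤ b i (p.1 i)}

/-! ### Computations with a step count

Unit-cost model over the real numbers: arithmetic operations and comparisons of real numbers,
operations on indices and Booleans, and reading or writing one array entry take constant time.
Arrays are functions on `Fin n`. -/

/-- A terminating computation: its value and the number of steps that it takes. -/
structure Timed (α : Type) where
  val : α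
  time : ℕ

instance : Monad Timed where
  pure a := ⟨a, 0⟩
  bind x f := ⟨(f x.val).val, x.time + (f x.val).time⟩

/-- One step: the evaluation of an expression with a bounded number of elementary operations. -/
def op {α : Type} (a : α) : Timed α := ⟨a, 1⟩

/-- Fill an array of length `n`, entry by entry. -/
def tabulate {n : ℕ} {α : Type} (f : Fin n → Timed α) : Timed (Fin n → α) :=
  ⟨fun i => (f i).val, ∑ i, ((f i).time + 1)⟩

/-- The loop `for i = 0, …, n - 1 do s ← f i s`. -/
def forLoop {n : ℕ} {α : Type} (s : α) (f : Fin n → α → Timed α) : Timed α :=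
  (List.finRange n).foldlM (fun s i => do
    let s' ← f i s
    op s') s

/-- A computation that need not terminate: a partial value together with a number of steps. -/
structure Comp (α : Type) where
  run : Part (Timed α)

instance : Monad Comp where
  pure a := ⟨Part.some ⟨a, 0⟩⟩
  bind x f := ⟨x.run.bind fun p => (f p.val).run.map fun q => ⟨q.val, p.time + q.time⟩⟩

instance : MonadLift Timed Comp where
  monadLift x := ⟨Part.some x⟩

/-- One round of a loop, from a state and the number of steps taken so far. -/
def loopRound {σ α : Type} (body : σ → Timed (σ ⊕ α)) (p : σ × ℕ) : Timed α ⊕ σ × ℕ :=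
  match (body p.1).val with
  | Sum.inl s => Sum.inr (s, p.2 + (body p.1).time + 1)
  | Sum.inr a => Sum.inl ⟨a, p.2 + (body p.1).time + 1⟩

/-- The unbounded loop: run `body` again and again, as long as it answers `Sum.inl s` with a new
state `s`; stop with the result `a` when it answers `Sum.inr a`.  Every round costs one step more
than its body.  The loop is undefined if `body` never answers `Sum.inr`. -/
def whileLoop {σ α : Type} (s : σ) (body : σ → Timed (σ ⊕ α)) : Comp α :=
  ⟨PFun.fix (PFun.lift (loopRound body)) (s, 0)⟩

/-- `x` terminates with the value `a` after exactly `t` steps. -/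
def Comp.HaltsIn {α : Type} (x : Comp α) (a : α) (t : ℕ) : Prop :=
  (⟨a, t⟩ : Timed α) ∈ x.run

/-! ### Elementary routines -/

/-- The first index with a property, if there is one. -/
def findFirst {n : ℕ} (p : Fin n → Timed Bool) : Timed (Option (Fin n)) :=
  forLoop none fun i found =>
    match found with
    | some j => op (some j)
    | none => do
      let b ← p i
      op (if b then some i else none)

/-- Is there an index with the property? -/
def existsIndex {n : ℕ} (p : Fin n → Timed Bool) : Timed Bool := do
  let found ← findFirst p
  op found.isSome

/-- The number of indices with the property, as a real number. -/
def countIndices {n : ℕ} (p : Fin n → Bool) : Timed ℝ :=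
  forLoop 0 fun i s => op (if p i then s + 1 else s)

/-- The sum of the entries of an array. -/
def sumEntries {n : ℕ} (x : Fin n → ℝ) : Timed ℝ :=
  forLoop 0 fun i s => op (s + x i)

/-- Minimum of two numbers, either of which may be missing. -/
def minOption : Option ℝ → Option ℝ → Option ℝ
  | none, y => y
  | x, none => x
  | some x, some y => some (if x ≤ y then x else y)

/-- The minimum of the numbers `f i` that are present, if there is one. -/
def minimum {n : ℕ} (f : Fin n → Timed (Option ℝ)) : Timed (Option ℝ) :=
  forLoop none fun i m => do
    let x ← f i
    op (minOption m x)

/-! ### Directed graphs on the set of rooms, as adjacency matrices -/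

abbrev Graph (n : ℕ) := Room n → Room n → Bool

/-- The reachability matrix (every room is reachable from itself). -/
def reachability {n : ℕ} (E : Graph n) : Timed (Graph n) := do
  let M ← tabulate fun a => tabulate fun c => op (E a c || decide (a = c))
  forLoop M fun k M =>
    tabulate fun a => tabulate fun c => op (M a c || (M a k && M k c))

/-- `R(X)`, given the reachability matrix `M`: the rooms reachable from some room of `X`. -/
def reachFrom {n : ℕ} (M : Graph n) (X : Room n → Bool) : Timed (Room n → Bool) :=
  tabulate fun c => existsIndex fun a => op (X a && M a c)

/-- `R⁻¹(X)`, given the reachability matrix `M`: the rooms that can reach some room of `X`. -/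
def reachTo {n : ℕ} (M : Graph n) (X : Room n → Bool) : Timed (Room n → Bool) :=
  tabulate fun a => existsIndex fun c => op (X c && M a c)

/-- Breadth-first search towards `x`: for every room `a ≠ x` that can reach `x`, the next room on
a shortest path from `a` to `x`. -/
def nextTowards {n : ℕ} (E : Graph n) (x : Room n) : Timed (Room n → Option (Room n)) :=
  forLoop (n := n) (fun _ => none) fun _ next =>
    tabulate fun a =>
      if a = x || (next a).isSome then op (next a)
      else findFirst fun c => op (E a c && (decide (c = x) || (next c).isSome))

/-- The assignment is stored by the array `occ` of the occupants of the rooms.  Given an edge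
`x → c` such that `c` can reach `x`, every agent on the cycle that consists of this edge and of a
shortest path from `c` back to `x` moves on to the next room of the cycle. -/
def reshuffle {n : ℕ} (E : Graph n) (occ : Room n → Agent n) (x c : Room n) :
    Timed (Room n → Agent n) := do
  let next ← nextTowards E x
  let start ← op (Function.update occ c (occ x), c)
  let final ← forLoop (n := n) start fun _ s =>
    if s.2 = x then op s
    else match next s.2 with
      | none => op s
      | some q => op (Function.update s.1 q (occ s.2), q)
  op final.1

/-! ### Envy graphs and continuous changes of the rents -/

/-- The amount by which the occupant of room `a` prefers room `c` to its own room. -/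
def envy {n : ℕ} (V : Agent n → Room n → ℝ) (occ : Room n → Agent n) (r : Room n → ℝ)
    (a c : Room n) : ℝ :=
  (V (occ a) c - r c) - (V (occ a) a - r a)

/-- The envy graph: `a → c` if the occupant of `a` weakly envies the occupant of `c`. -/
def envyGraph {n : ℕ} (V : Agent n → Room n → ℝ) (occ : Room n → Agent n) (r : Room n → ℝ) :
    Timed (Graph n) :=
  tabulate fun a => tabulate fun c => op (decide (0 ≤ envy V occ r a c))

/-- The first positive time at which a quantity reaches a target, if it changes at the constant
rate `rate` and the target exceeds its present value by `gap`. -/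
def hitTime (gap rate : ℝ) : Option ℝ :=
  if rate ≠ 0 ∧ 0 < gap / rate then some (gap / rate) else none

/-- The rents change at the constant rates `d`.  The first positive time at which an envy edge
becomes a weak envy edge (one with equal utilities). -/
def nextWeakEdge {n : ℕ} (V : Agent n → Room n → ℝ) (occ : Room n → Agent n)
    (r d : Room n → ℝ) : Timed (Option ℝ) :=
  minimum fun a => minimum fun c => op (hitTime (envy V occ r a c) (d c - d a))

/-- The rates: unit rate of change on `up`, and the rate `|up| / |down|` downwards on `down`, so
that the total rent stays constant. -/
def ratesUnitUp {n : ℕ} (up down : Room n → Bool) : Timed (Room n → ℝ) := do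
  let p ← countIndices up
  let q ← countIndices down
  tabulate fun j => op (if up j then 1 else if down j then -(p / q) else 0)

/-- The rates: unit rate downwards on `down`, and the rate `|down| / |up|` on `up`. -/
def ratesUnitDown {n : ℕ} (down up : Room n → Bool) : Timed (Room n → ℝ) := do
  let p ← countIndices down
  let q ← countIndices up
  tabulate fun j => op (if down j then -1 else if up j then p / q else 0)

/-- The rents after the time `t`. -/
def advance {n : ℕ} (r d : Room n → ℝ) (t : Option ℝ) : Timed (Room n → ℝ) :=
  tabulate fun j => op (r j + t.getD 0 * d j)

/-! ### An initial envy-free allocation -/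

/-- Klijn's algorithm, started at an arbitrary allocation.
If a strong envy edge lies on a cycle of the envy graph, the agents move along such a cycle.
Otherwise, for some strong envy edge `i → j`, the rents of `R⁻¹(i)` decrease and those of `R(j)`
increase, with constant total, until a weak envy edge appears.
The algorithm stops when there is no strong envy edge. -/
def klijn {n : ℕ} (V : Agent n → Room n → ℝ) :
    Comp ((Room n → Agent n) × (Room n → ℝ)) := do
  let occ ← tabulate (n := n) fun j => op j
  let r ← tabulate (n := n) fun _ => op (0 : ℝ)
  whileLoop (occ, r) fun (occ, r) => do
    let E ← envyGraph V occ r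
    let M ← reachability E
    let strong ← tabulate fun a => tabulate fun c => op (decide (0 < envy V occ r a c))
    -- the target of the first strong edge out of each room, on a cycle or anywhere
    let onCycle ← tabulate fun a => findFirst fun c => op (strong a c && M c a)
    let anywhere ← tabulate fun a => findFirst fun c => op (strong a c)
    let x ← findFirst fun a => op (onCycle a).isSome
    let i ← findFirst fun a => op (anywhere a).isSome
    match x.bind fun x => (onCycle x).map fun c => (x, c) with
    | some (x, c) => do
      let occ' ← reshuffle E occ x c
      return Sum.inl (occ', r)
    | none =>
      match i.bind fun i => (anywhere i).map fun j => (i, j) with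
      | some (i, j) => do
        let down ← tabulate fun a => op (M a i)
        let up ← tabulate fun a => op (M j a)
        let d ← ratesUnitDown down up
        let t ← nextWeakEdge V occ r d
        let r' ← advance r d t
        return Sum.inl (occ, r')
      | none => return Sum.inr (occ, r)

/-! ### Maximum rent in one component -/

/-- The budget-aware envy graph of the subproblem given by the rooms of `C` and their occupants:
`a → c` if the occupant of `a` weakly envies that of `c` and its budget for `c` exceeds the rent
of `c`. -/
def budgetGraph {n : ℕ} (V b : Agent n → Room n → ℝ) (C : Room n → Bool)
    (occ : Room n → Agent n) (r : Room n → ℝ) : Timed (Graph n) :=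
  tabulate fun a => tabulate fun c =>
    op (C a && C c && decide (0 ≤ envy V occ r a c) && decide (r c < b (occ a) c))

/-- The minimum over the rooms of `C` of the difference between the budget of the occupant and the
rent. -/
def minSlack {n : ℕ} (b : Agent n → Room n → ℝ) (C : Room n → Bool)
    (occ : Room n → Agent n) (r : Room n → ℝ) : Timed (Option ℝ) :=
  minimum fun a => op (if C a then some (b (occ a) a - r a) else none)

/-- Add the number `t` to the rents of the rooms of `C`. -/
def shiftRents {n : ℕ} (C : Room n → Bool) (r : Room n → ℝ) (t : Option ℝ) :
    Timed (Room n → ℝ) :=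
  tabulate fun a => op (if C a then r a + t.getD 0 else r a)

/-- The algorithm SCC-EF-Rents on the subproblem given by the rooms of `C` and their occupants.
`(occ, r)` is an allocation that is envy-free on this subproblem (its initial envy-free solution);
entries outside `C` are not used.
The rents of `C` are first shifted by a common amount that makes all of them respect the budgets,
with equality for some agent.  Then, as long as every agent whose rent equals its budget lies on a
cycle of the budget-aware envy graph: if there is no such agent, all rents increase by the smallest
slack (Case 1); otherwise, one such agent moves along a cycle (Case 2).
The result is the total rent in `C` and the allocation. -/
def sccEFRents {n : ℕ} (V b : Agent n → Room n → ℝ) (C : Room n → Bool)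
    (occ : Room n → Agent n) (r : Room n → ℝ) :
    Comp (ℝ × (Room n → Agent n) × (Room n → ℝ)) := do
  let t ← minSlack b C occ r
  let r₀ ← shiftRents C r t
  whileLoop (occ, r₀) fun (occ, r) => do
    let E ← budgetGraph V b C occ r
    let M ← reachability E
    let tight ← tabulate fun a => op (C a && decide (r a = b (occ a) a))
    -- a successor of `a` on a cycle through `a`, if there is one
    let succ ← tabulate fun a => findFirst fun c => op (E a c && M c a)
    let stuck ← existsIndex fun a => op (tight a && (succ a).isNone)
    let x ← findFirst fun a => op (tight a)
    if stuck then
      let rC ← tabulate fun a => op (if C a then r a else 0)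
      let total ← sumEntries rC
      return Sum.inr (total, occ, r)
    else
      match x with
      | none => do
        let t ← minSlack b C occ r
        let r' ← shiftRents C r t
        return Sum.inl (occ, r')
      | some x =>
        match succ x with
        | none => return Sum.inl (occ, r)
        | some c => do
          let occ' ← reshuffle E occ x c
          return Sum.inl (occ', r)

/-! ### Envy-free rents within bounds -/

/-- The algorithm BoundsAware-EF-Rents: given an assignment, envy-free rents `r`, lower bounds `l`
(`none` is `-∞`) and upper bounds `u`, change `r` continuously, with constant total, until it
respects the bounds; the result `none` means "no solution".
`low`, `lowF`, `high`, `highF` are the sets of the rooms with rent below, at the lower bound, above,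
at the upper bound.
The rents change at constant rates up to the first positive time at which a weak envy edge appears
or the rent of a room reaches a bound.  (A room that is at a bound may leave it at once; this
changes neither of the sets `inc` and `dec`.)
There is also no solution when no room is left whose rent can change to keep the total constant. -/
def boundsAwareEFRents {n : ℕ} (V : Agent n → Room n → ℝ) (occ : Room n → Agent n)
    (r : Room n → ℝ) (l : Room n → Option ℝ) (u : Room n → ℝ) :
    Comp (Option (Room n → ℝ)) :=
  whileLoop r fun r => do
    let low ← tabulate fun j => op ((l j).any fun x => decide (r j < x))
    let lowF ← tabulate fun j => op ((l j).any fun x => decide (r j = x))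
    let high ← tabulate fun j => op (decide (u j < r j))
    let highF ← tabulate fun j => op (decide (r j = u j))
    let anyLow ← existsIndex fun j => op (low j)
    let anyHigh ← existsIndex fun j => op (high j)
    if !anyLow && !anyHigh then
      return Sum.inr (some r)
    else
      let E ← envyGraph V occ r
      let M ← reachability E
      let lowOrAt ← tabulate fun j => op (low j || lowF j)
      let highOrAt ← tabulate fun j => op (high j || highF j)
      let fromLow ← reachFrom M lowOrAt
      let toHigh ← reachTo M highOrAt
      let highBlocked ← existsIndex fun j => op (high j && fromLow j)
      let lowBlocked ← existsIndex fun j => op (low j && toHigh j)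
      let inc ← if anyLow then reachFrom M low else tabulate fun j => op (!toHigh j)
      let dec ← if anyHigh then reachTo M high else tabulate fun j => op (!fromLow j)
      let anyInc ← existsIndex fun j => op (inc j)
      let anyDec ← existsIndex fun j => op (dec j)
      if highBlocked || lowBlocked || !anyInc || !anyDec then
        return Sum.inr none
      else
        let d ← ratesUnitUp inc dec
        let t₁ ← nextWeakEdge V occ r d
        let t₂ ← minimum fun j => op (hitTime (u j - r j) (d j))
        let t₃ ← minimum fun j => op ((l j).bind fun x => hitTime (x - r j) (d j))
        let t ← op (minOption t₁ (minOption t₂ t₃))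
        let r' ← advance r d t
        return Sum.inl r'

/-! ### The main algorithm -/

/-- The algorithm BudgetAware-EF.  The result is an assignment (the room of every agent) with rents
for the rooms, or `none`, which means "no solution". -/
def budgetAwareEF {n : ℕ} (V b : Agent n → Room n → ℝ) (Rt : ℝ) :
    Comp (Option ((Agent n → Room n) × (Room n → ℝ))) := do
  -- an initial envy-free allocation
  let (occ₀, r₀) ← klijn V
  -- strongly connected components of its envy graph
  let E ← envyGraph V occ₀ r₀
  let M ← reachability E
  let same ← tabulate fun a => tabulate fun c => op (M a c && M c a)
  -- for each component `C`, given by its first room `c`, the assignment on `C` is replaced by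
  -- the one that attains the maximum rent
  let occ ← (List.finRange n).foldlM (fun occ c => do
    let notFirst ← existsIndex fun a => op (decide (a < c) && same c a)
    if notFirst then
      return occ
    else
      let C ← tabulate fun a => op (same c a)
      let (_, occC, _) ← sccEFRents V b C occ₀ r₀
      tabulate fun a => op (if C a then occC a else occ a)) occ₀
  -- envy-free rents with total `Rt` for the combined assignment
  let total ← sumEntries r₀
  let r ← tabulate fun j => op (r₀ j + (Rt - total) / n)
  -- the bounds algorithm, with the budgets of the occupants as upper bounds
  let u ← tabulate fun j => op (b (occ j) j)
  let result ← boundsAwareEFRents V occ r (fun _ => none) u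
  match result with
  | none => return none
  | some r' => do
    let room ← forLoop (n := n) occ fun j s => op (Function.update s (occ j) j)
    return some (room, r')

end RentDivision

end

noncomputable section

namespace RentDivision

/-! ### Specifications of timed computations -/

/-! Correctness rests on comparison with an arbitrary envy-free allocation `(σ, s)` of any total
rent. Summing envies over all agents makes the rents cancel, so an envy-free assignment maximizes
total value and every agent is indifferent between its rooms in two such assignments
(`optimal_of_envyFree`). Hence the rents `s` are also envy-free for the assignment found by Klijn's
algorithm. Moreover `s - r₀` cannot decrease along an edge of the envy graph of `r₀`
(`sub_le_sub_of_reach`), so it is constant on each strongly connected component.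

Maximizing the rent on one component `C` then gives an assignment that serves all solutions at once.
If a solution had larger rents on `C` than the final ones, moving everybody to the room assigned by
`σ` would be a permutation of `C` along edges of the budget-aware envy graph. So every room of `C`,
the stuck one included, would lie on a cycle. Thus the rents of every solution respect the budgets
of the new occupants (`IsComponentSolution.le_budget`). The search becomes a problem for one fixed
assignment: envy-free rents of total `Rt` below `u`. If the bounds algorithm has no room left to
raise, every room reaches one at or above its bound, and monotonicity of `s - r` makes the total of
any admissible `s` smaller than `Rt` (`sum_lt_of_reachesBound`).

Running times come from integer potentials, lexicographic pairs coded as one number. Klijn's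
algorithm loses a strong edge or enlarges the set reaching `i` or reachable from `j`, for an
unchanged strong edge `i → j`. The component algorithm loses an agent-room pair with rent below
budget, or keeps these and loses a tight agent. The bounds algorithm loses a room above its bound or
enlarges the set of rooms that reach one above, or at least at, its bound. -/

/-- `x` takes at most `T` steps and its value satisfies `Q`. -/
def Timed.Spec {α : Type} (x : Timed α) (T : ℕ) (Q : α → Prop) : Prop :=
  x.time ≤ T ∧ Q x.val

/-- `x` terminates after at most `T` steps with a value that satisfies `Q`. -/
def Comp.Spec {α : Type} (x : Comp α) (T : ℕ) (Q : α → Prop) : Prop :=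
  ∃ a t, x.HaltsIn a t ∧ t ≤ T ∧ Q a

theorem Timed.Spec.mono {α : Type} {x : Timed α} {T T' : ℕ} {Q Q' : α → Prop}
    (h : x.Spec T Q) (hT : T ≤ T') (hQ : ∀ a, Q a → Q' a) : x.Spec T' Q' :=
  ⟨h.1.trans hT, hQ _ h.2⟩

theorem Timed.Spec.pure {α : Type} {a : α} {Q : α → Prop} (h : Q a) :
    (pure a : Timed α).Spec 0 Q :=
  ⟨le_rfl, h⟩

theorem Timed.Spec.bind {α β : Type} {x : Timed α} {f : α → Timed β} {T₁ T₂ : ℕ}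
    {P : α → Prop} {Q : β → Prop} (hx : x.Spec T₁ P) (hf : ∀ a, P a → (f a).Spec T₂ Q) :
    (x >>= f).Spec (T₁ + T₂) Q :=
  ⟨Nat.add_le_add hx.1 (hf _ hx.2).1, (hf _ hx.2).2⟩

theorem op_spec {α : Type} (a : α) : (op a).Spec 1 (· = a) :=
  ⟨le_rfl, rfl⟩

theorem op_spec' {α : Type} {a : α} {Q : α → Prop} (h : Q a) : (op a).Spec 1 Q :=
  ⟨le_rfl, h⟩

theorem Comp.Spec.mono {α : Type} {x : Comp α} {T T' : ℕ} {Q Q' : α → Prop}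
    (h : x.Spec T Q) (hT : T ≤ T') (hQ : ∀ a, Q a → Q' a) : x.Spec T' Q' :=
  let ⟨a, t, h₁, h₂, h₃⟩ := h
  ⟨a, t, h₁, h₂.trans hT, hQ _ h₃⟩

theorem Comp.Spec.pure {α : Type} {a : α} {Q : α → Prop} (h : Q a) :
    (pure a : Comp α).Spec 0 Q :=
  ⟨a, 0, Part.mem_some _, le_rfl, h⟩

theorem Timed.Spec.lift {α : Type} {x : Timed α} {T : ℕ} {Q : α → Prop} (h : x.Spec T Q) :
    (liftM x : Comp α).Spec T Q :=
  ⟨x.val, x.time, Part.mem_some _, h.1, h.2⟩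

theorem Comp.Spec.bind {α β : Type} {x : Comp α} {f : α → Comp β} {T₁ T₂ : ℕ}
    {P : α → Prop} {Q : β → Prop} (hx : x.Spec T₁ P) (hf : ∀ a, P a → (f a).Spec T₂ Q) :
    (x >>= f).Spec (T₁ + T₂) Q := by
  obtain ⟨a, t, ha, ht, hP⟩ := hx
  obtain ⟨c, s, hc, hs, hQ⟩ := hf a hP
  exact ⟨c, t + s, Part.mem_bind ha (Part.mem_map (fun q : Timed β =>
    (⟨q.val, t + q.time⟩ : Timed β)) hc), Nat.add_le_add ht hs, hQ⟩

/-- A potential of at most `N` allows at most `N + 1` rounds, the last one being the round that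
stops. Definedness of the partial fixed point comes from the same induction. -/
theorem whileLoop_spec {σ α : Type} {body : σ → Timed (σ ⊕ α)} (I : σ → Prop) (Φ : σ → ℕ)
    {T N : ℕ} {Q : α → Prop}
    (hbody : ∀ s, I s → (body s).Spec T
      fun v => (∀ s', v = Sum.inl s' → I s' ∧ Φ s' < Φ s) ∧ ∀ a, v = Sum.inr a → Q a)
    {s : σ} (hs : I s) (hN : Φ s ≤ N) :
    (whileLoop s body).Spec ((N + 1) * (T + 1)) Q := by
  -- The step counter is part of the loop state, so the induction is over all starting counts `t`.
  have key : ∀ N s t, I s → Φ s ≤ N → ∃ a t', t' ≤ t + (N + 1) * (T + 1) ∧ Q a ∧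
      (⟨a, t'⟩ : Timed α) ∈ PFun.fix (PFun.lift (loopRound body)) (s, t) := by
    intro N
    induction N with
    | zero =>
      intro s t hI hΦ
      obtain ⟨hT, h₁, h₂⟩ := hbody s hI
      cases hv : (body s).val with
      | inl s' => have := (h₁ s' hv).2; omega
      | inr a =>
        refine ⟨a, t + (body s).time + 1, by omega, h₂ a hv, PFun.fix_stop ?_⟩
        simp [PFun.lift, loopRound, hv]
    | succ N ih =>
      intro s t hI hΦ
      obtain ⟨hT, h₁, h₂⟩ := hbody s hI
      cases hv : (body s).val with
      | inl s' =>
        obtain ⟨hI', hlt⟩ := h₁ s' hv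
        obtain ⟨a, t', ht', hQ, hmem⟩ := ih s' (t + (body s).time + 1) hI' (by omega)
        refine ⟨a, t', ht'.trans ?_, hQ, ?_⟩
        · have : (N + 1 + 1) * (T + 1) = (N + 1) * (T + 1) + (T + 1) := by ring
          omega
        · rw [PFun.fix_fwd_eq (a' := (s', t + (body s).time + 1))]
          · exact hmem
          · simp [PFun.lift, loopRound, hv]
      | inr a =>
        refine ⟨a, t + (body s).time + 1, ?_, h₂ a hv, PFun.fix_stop ?_⟩
        · have : (N + 1 + 1) * (T + 1) = (N + 1) * (T + 1) + (T + 1) := by ring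
          omega
        · simp [PFun.lift, loopRound, hv]
  obtain ⟨a, t, ht, hQ, hmem⟩ := key N s 0 hs hN
  exact ⟨a, t, hmem, by omega, hQ⟩

/-! ### Rules for arrays and loops over indices -/

theorem tabulate_spec {n : ℕ} {α : Type} {f : Fin n → Timed α} {T : ℕ} {Q : Fin n → α → Prop}
    (h : ∀ i, (f i).Spec T (Q i)) :
    (tabulate f).Spec (n * (T + 1)) fun g => ∀ i, Q i (g i) := by
  refine ⟨?_, fun i => (h i).2⟩
  calc ∑ i, ((f i).time + 1) ≤ ∑ _i : Fin n, (T + 1) :=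
        Finset.sum_le_sum fun i _ => Nat.add_le_add_right (h i).1 1
    _ = n * (T + 1) := by simp

theorem tabulate_op_spec {n : ℕ} {α : Type} (f : Fin n → α) :
    (tabulate fun i => op (f i)).Spec (n * 2) (· = f) :=
  (tabulate_spec fun i => op_spec (f i)).mono le_rfl fun _ h => funext h

theorem tabulate_tabulate_op_spec {n : ℕ} {α : Type} (f : Fin n → Fin n → α) :
    (tabulate fun i => tabulate fun j => op (f i j)).Spec (n * (n * 2 + 1)) (· = f) :=
  (tabulate_spec fun i => tabulate_op_spec (f i)).mono le_rfl fun _ h => funext h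

theorem Timed.foldlM_finRange_spec {n : ℕ} {α : Type} {f : α → Fin n → Timed α} {T : ℕ}
    (motive : ℕ → α → Prop) (hf : ∀ (i : Fin n) s, motive i s → (f s i).Spec T (motive (i + 1)))
    {s : α} (hs : motive 0 s) :
    ((List.finRange n).foldlM f s).Spec (n * T) (motive n) := by
  -- Induction on the number `m` of remaining indices, the processed ones being the first `k`.
  have key : ∀ m k s, k + m = n → motive k s →
      (((List.finRange n).drop k).foldlM f s).Spec (m * T) (motive n) := by
    intro m
    induction m with
    | zero =>
      intro k s hk h
      rw [List.drop_of_length_le (by simp; omega)]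
      exact (Timed.Spec.pure (by simpa [show k = n by omega] using h)).mono (by simp) fun _ h => h
    | succ m ih =>
      intro k s hk h
      rw [List.drop_eq_getElem_cons (by simp; omega), List.foldlM_cons]
      refine ((hf _ s ?_).bind fun a ha => ih (k + 1) a (by omega) ?_).mono (by linarith)
        fun _ h => h
      · simpa using h
      · simpa using ha
  simpa using key n 0 s (by omega) hs

theorem Comp.foldlM_finRange_spec {n : ℕ} {α : Type} {f : α → Fin n → Comp α} {T : ℕ}
    (motive : ℕ → α → Prop) (hf : ∀ (i : Fin n) s, motive i s → (f s i).Spec T (motive (i + 1)))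
    {s : α} (hs : motive 0 s) :
    ((List.finRange n).foldlM f s).Spec (n * T) (motive n) := by
  have key : ∀ m k s, k + m = n → motive k s →
      (((List.finRange n).drop k).foldlM f s).Spec (m * T) (motive n) := by
    intro m
    induction m with
    | zero =>
      intro k s hk h
      rw [List.drop_of_length_le (by simp; omega)]
      exact (Comp.Spec.pure (by simpa [show k = n by omega] using h)).mono (by simp) fun _ h => h
    | succ m ih =>
      intro k s hk h
      rw [List.drop_eq_getElem_cons (by simp; omega), List.foldlM_cons]
      refine ((hf _ s ?_).bind fun a ha => ih (k + 1) a (by omega) ?_).mono (by linarith)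
        fun _ h => h
      · simpa using h
      · simpa using ha
  simpa using key n 0 s (by omega) hs

theorem forLoop_spec {n : ℕ} {α : Type} {f : Fin n → α → Timed α} {T : ℕ}
    (motive : ℕ → α → Prop) (hf : ∀ (i : Fin n) s, motive i s → (f i s).Spec T (motive (i + 1)))
    {s : α} (hs : motive 0 s) :
    (forLoop s f).Spec (n * (T + 1)) (motive n) :=
  Timed.foldlM_finRange_spec motive
    (fun i s h => (hf i s h).bind fun _ ha => op_spec' ha) hs

/-! ### Elementary routines -/

/-- That the index is the smallest one is not recorded: any index with the property will do. -/
theorem findFirst_spec {n : ℕ} {p : Fin n → Timed Bool} {q : Fin n → Bool} {T : ℕ}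
    (hp : ∀ i, (p i).Spec T (· = q i)) :
    (findFirst p).Spec (n * (T + 2)) fun o =>
      (o = none → ∀ i, q i = false) ∧ ∀ i, o = some i → q i = true := by
  refine (forLoop_spec (T := T + 1)
    (fun k o => (o = none → ∀ i : Fin n, i < k → q i = false) ∧ ∀ i, o = some i → q i = true)
    ?_ ?_).mono le_rfl ?_
  · rintro i (_ | j) ⟨h₁, h₂⟩
    · refine (hp i).bind ?_
      rintro _ rfl
      refine op_spec' ⟨?_, ?_⟩
      · intro h j hj
        rcases Nat.lt_succ_iff_lt_or_eq.1 hj with hj | hj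
        · exact h₁ rfl j hj
        · obtain rfl : j = i := Fin.ext hj
          simpa using h
      · intro j h
        by_cases hq : q i <;> simp_all
    · exact (op_spec' ⟨by simp, h₂⟩).mono (by omega) fun _ h => h
  · simp
  · rintro o ⟨h₁, h₂⟩
    exact ⟨fun h i => h₁ h i i.2, h₂⟩

theorem existsIndex_spec {n : ℕ} {p : Fin n → Timed Bool} {q : Fin n → Bool} {T : ℕ}
    (hp : ∀ i, (p i).Spec T (· = q i)) :
    (existsIndex p).Spec (n * (T + 2) + 1) fun b => (b = true ↔ ∃ i, q i = true) := by
  refine (findFirst_spec hp).bind ?_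
  rintro (_ | j) ⟨h₁, h₂⟩
  · exact op_spec' (by simp [h₁ rfl])
  · exact op_spec' (by simpa using ⟨j, h₂ j rfl⟩)

theorem existsIndex_op_spec {n : ℕ} (q : Fin n → Bool) :
    (existsIndex fun i => op (q i)).Spec (n * 3 + 1) fun b => (b = true ↔ ∃ i, q i = true) :=
  existsIndex_spec fun i => op_spec (q i)

theorem findFirst_op_spec {n : ℕ} (q : Fin n → Bool) :
    (findFirst fun i => op (q i)).Spec (n * 3) fun o =>
      (o = none → ∀ i, q i = false) ∧ ∀ i, o = some i → q i = true :=
  findFirst_spec fun i => op_spec (q i)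

theorem sum_filter_lt_succ {n : ℕ} (i : Fin n) (g : Fin n → ℝ) :
    ∑ j : Fin n with j.val < i.val + 1, g j = ∑ j : Fin n with j.val < i.val, g j + g i := by
  rw [show (Finset.univ.filter fun j : Fin n => j.val < i.val + 1)
      = insert i (Finset.univ.filter fun j : Fin n => j.val < i.val) by
    ext j; simp [Fin.ext_iff]; omega]
  rw [Finset.sum_insert (by simp), add_comm]

theorem sumEntries_spec {n : ℕ} (x : Fin n → ℝ) :
    (sumEntries x).Spec (n * 2) (· = ∑ i, x i) := by
  refine (forLoop_spec (T := 1) (fun k s => s = ∑ j : Fin n with j.val < k, x j) ?_ ?_).mono le_rfl ?_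
  · rintro i _ rfl
    exact op_spec' (sum_filter_lt_succ i x).symm
  · simp
  · rintro _ rfl
    simp

theorem countIndices_spec {n : ℕ} (p : Fin n → Bool) :
    (countIndices p).Spec (n * 2) (· = ∑ i, if p i then (1 : ℝ) else 0) := by
  refine (forLoop_spec (T := 1)
    (fun k s => s = ∑ j : Fin n with j.val < k, if p j then (1 : ℝ) else 0) ?_ ?_).mono le_rfl ?_
  · rintro i _ rfl
    refine op_spec' ?_
    rw [sum_filter_lt_succ]
    split <;> simp
  · simp
  · rintro _ rfl
    simp

/-- `m` is the minimum of the numbers `f i` that are present. -/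
def IsMinimum {ι : Type} (f : ι → Option ℝ) (m : Option ℝ) : Prop :=
  (∀ i t, f i = some t → ∃ s, m = some s ∧ s ≤ t) ∧ ∀ s, m = some s → ∃ i, f i = some s

theorem minimum_spec {n : ℕ} {f : Fin n → Timed (Option ℝ)} {Q : Fin n → Option ℝ → Prop} {T : ℕ}
    (hf : ∀ i, (f i).Spec T (Q i)) :
    (minimum f).Spec (n * (T + 2)) fun m => ∃ g, (∀ i, Q i (g i)) ∧ IsMinimum g m := by
  suffices h : (minimum f).Spec (n * (T + 2)) (IsMinimum fun i => (f i).val) from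
    h.mono le_rfl fun m hm => ⟨_, fun i => (hf i).2, hm⟩
  refine (forLoop_spec (T := T + 1) (fun k m => (∀ i : Fin n, (i : ℕ) < k → ∀ t,
    (f i).val = some t → ∃ s, m = some s ∧ s ≤ t) ∧ ∀ s, m = some s → ∃ i, (f i).val = some s)
    ?_ ?_).mono le_rfl ?_
  · rintro i m ⟨h₁, h₂⟩
    refine Timed.Spec.bind (P := (· = (f i).val)) ⟨(hf i).1, rfl⟩ ?_
    rintro _ rfl
    refine op_spec' ⟨?_, ?_⟩
    · intro j hj t ht
      rcases Nat.lt_succ_iff_lt_or_eq.1 hj with hj | hj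
      · obtain ⟨s, rfl, hs⟩ := h₁ j hj t ht
        cases hx : (f i).val with
        | none => exact ⟨s, rfl, hs⟩
        | some x =>
          refine ⟨_, rfl, ?_⟩
          split
          · exact hs
          · linarith
      · obtain rfl : j = i := Fin.ext hj
        rw [ht]
        cases m with
        | none => exact ⟨t, rfl, le_rfl⟩
        | some x =>
          refine ⟨_, rfl, ?_⟩
          split
          · assumption
          · exact le_rfl
    · intro s hs
      cases m with
      | none => exact ⟨i, by simpa [minOption] using hs⟩
      | some x =>
        cases hx : (f i).val with
        | none => exact h₂ s (by simpa [minOption, hx] using hs)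
        | some y =>
          rw [hx] at hs
          simp only [minOption, Option.some.injEq] at hs
          split at hs
          · exact h₂ s (by simp [hs])
          · exact ⟨i, by simp [hx, hs]⟩
  · simp
  · rintro m ⟨h₁, h₂⟩
    exact ⟨fun i => h₁ i i.2, h₂⟩

theorem minimum_op_spec {n : ℕ} (f : Fin n → Option ℝ) :
    (minimum fun i => op (f i)).Spec (n * 3) (IsMinimum f) :=
  (minimum_spec fun i => op_spec (f i)).mono le_rfl fun m ⟨g, hg, hm⟩ => by
    rwa [show g = f from funext hg] at hm

/-! ### Graph routines -/

/-- There is a walk from `a` to `c` in the graph `E`. -/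
abbrev Graph.Reach {n : ℕ} (E : Graph n) (a c : Room n) : Prop :=
  Relation.ReflTransGen (fun a c => E a c = true) a c

/-- Cost bounds live in an arbitrary commutative semiring, so that one expression gives the step
bound at `n` and the polynomial at `X`. Their nesting follows the sequence of binds. -/
def reachCost {R : Type} [CommSemiring R] (x : R) : R :=
  x * (x * 2 + 1) + x * (x * (x * 2 + 1) + 1)

/-- Warshall's algorithm. After `k` rounds the matrix contains `E`, is reflexive and sound, and is
transitive through every intermediate room of index below `k`; after `n` rounds it is transitive. -/
theorem reachability_spec {n : ℕ} (E : Graph n) :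
    (reachability E).Spec (reachCost n) fun M => ∀ a c, M a c = true ↔ E.Reach a c := by
  refine (tabulate_tabulate_op_spec _).bind ?_
  rintro _ rfl
  refine (forLoop_spec (fun k M => (∀ a c, E a c = true → M a c = true) ∧
    (∀ a, M a a = true) ∧ (∀ a c, M a c = true → E.Reach a c) ∧
    ∀ m : Fin n, m.val < k → ∀ a c, M a m = true → M m c = true → M a c = true)
    ?_ ?_).mono le_rfl ?_
  · rintro k M ⟨hE, hr, hs, hc⟩
    refine (tabulate_tabulate_op_spec _).mono le_rfl ?_
    rintro _ rfl
    refine ⟨fun a c h => ?_, fun a => ?_, fun a c h => ?_, fun m hm a c h₁ h₂ => ?_⟩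
    · simp [hE a c h]
    · simp [hr a]
    · simp only [Bool.or_eq_true, Bool.and_eq_true] at h
      rcases h with h | ⟨h₁, h₂⟩
      · exact hs _ _ h
      · exact (hs _ _ h₁).trans (hs _ _ h₂)
    · simp only [Bool.or_eq_true, Bool.and_eq_true] at h₁ h₂ ⊢
      rcases Nat.lt_succ_iff_lt_or_eq.1 hm with hm | hm
      · have := hc m hm
        rcases h₁ with h₁ | ⟨h₁, h₁'⟩ <;> rcases h₂ with h₂ | ⟨h₂, h₂'⟩
        · exact Or.inl (this _ _ h₁ h₂)
        · exact Or.inr ⟨this _ _ h₁ h₂, h₂'⟩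
        · exact Or.inr ⟨h₁, this _ _ h₁' h₂⟩
        · exact Or.inr ⟨h₁, h₂'⟩
      · obtain rfl : m = k := Fin.ext hm
        exact Or.inr ⟨h₁.elim id fun h => h.1, h₂.elim id fun h => h.2⟩
  · refine ⟨fun a c h => by simp [h], fun a => by simp, fun a c h => ?_, by simp⟩
    simp only [Bool.or_eq_true, decide_eq_true_eq] at h
    rcases h with h | rfl
    · exact .single h
    · exact .refl
  · rintro M ⟨hE, hr, hs, hc⟩ a c
    refine ⟨hs a c, fun h => ?_⟩
    induction h with
    | refl => exact hr a
    | tail _ h ih => exact hc _ (Fin.is_lt _) _ _ ih (hE _ _ h)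

def reachSetCost {R : Type} [CommSemiring R] (x : R) : R := x * (x * 3 + 1 + 1)

theorem reachFrom_spec {n : ℕ} (M : Graph n) (X : Room n → Bool) :
    (reachFrom M X).Spec (reachSetCost n)
      fun Y => ∀ c, Y c = true ↔ ∃ a, X a = true ∧ M a c = true :=
  (tabulate_spec fun _ => existsIndex_op_spec _).mono le_rfl fun Y h c => by
    simpa using h c

theorem reachTo_spec {n : ℕ} (M : Graph n) (X : Room n → Bool) :
    (reachTo M X).Spec (reachSetCost n)
      fun Y => ∀ a, Y a = true ↔ ∃ c, X c = true ∧ M a c = true :=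
  (tabulate_spec fun _ => existsIndex_op_spec _).mono le_rfl fun Y h c => by
    simpa using h c

/-- The array `next` of successors that lead to `x`, with distances `rank` to `x`. -/
structure IsNextTowards {n : ℕ} (E : Graph n) (x : Room n) (next : Room n → Option (Room n))
    (rank : Room n → ℕ) (k : ℕ) : Prop where
  target : next x = none
  edge : ∀ a q, next a = some q → E a q = true
  decreasing : ∀ a q, next a = some q →
    0 < rank a ∧ rank a ≤ k ∧ (q = x ∨ (next q).isSome ∧ rank q < rank a)

def nextTowardsCost {R : Type} [CommSemiring R] (x : R) : R := x * (x * (x * 3 + 1 + 1) + 1)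

/-- Each round either finds the reached set closed under predecessors or reaches at least one new
room. As `x` never receives a successor, fewer than `n` rooms can do so, and the set is closed after
`n` rounds. -/
theorem nextTowards_spec {n : ℕ} (E : Graph n) (x : Room n) :
    (nextTowards E x).Spec (nextTowardsCost n) fun next =>
      (∃ rank, IsNextTowards E x next rank n) ∧
      ∀ a, E.Reach a x → a = x ∨ (next a).isSome := by
  refine (forLoop_spec (T := n * (n * 3 + 1 + 1)) (fun k next =>
    (∃ rank, IsNextTowards E x next rank k) ∧
    ((∀ a c, E a c = true → (c = x ∨ (next c).isSome) → a = x ∨ (next a).isSome) ∨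
      k ≤ (Finset.univ.filter fun a => (next a).isSome).card)) ?_ ?_).mono le_rfl ?_
  · rintro k next ⟨⟨rank, h₁, h₂, h₃⟩, hcard⟩
    refine (tabulate_spec (T := n * 3 + 1) (Q := fun a o =>
      ((a = x ∨ (next a).isSome) → o = next a) ∧
      (¬ (a = x ∨ (next a).isSome) →
        (o = none → ∀ c, ¬ (E a c = true ∧ (c = x ∨ (next c).isSome))) ∧
        ∀ c, o = some c → E a c = true ∧ (c = x ∨ (next c).isSome))) ?_).mono le_rfl ?_
    · intro a
      split_ifs with h <;> rw [Bool.or_eq_true, decide_eq_true_eq] at h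
      · exact (op_spec _).mono (by omega) (by rintro _ rfl; exact ⟨fun _ => rfl, absurd h⟩)
      · refine (findFirst_op_spec _).mono (by omega) ?_
        rintro o ⟨ho₁, ho₂⟩
        refine ⟨fun h' => absurd h' h, fun _ => ⟨fun ho c hc => ?_, fun c hc => ?_⟩⟩
        · have := ho₁ ho c
          simp only [hc.1, Bool.true_and, Bool.or_eq_false_iff, decide_eq_false_iff_not] at this
          exact hc.2.elim this.1 (by simp [this.2])
        · simpa using ho₂ c hc
    · intro next' hnext'
      have hold : ∀ a, (next a).isSome → next' a = next a := fun a h => (hnext' a).1 (Or.inr h)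
      have hx : next' x = none := ((hnext' x).1 (Or.inl rfl)).trans h₁
      have hnew : ∀ a q, next' a = some q → ¬ (next a).isSome →
          E a q = true ∧ (q = x ∨ (next q).isSome) := by
        intro a q h hs
        refine ((hnext' a).2 ?_).2 q h
        rintro (rfl | h')
        · rw [hx] at h; cases h
        · exact hs h'
      -- The rank is the round in which a room is reached, so it falls along successors.
      refine ⟨⟨fun a => if (next a).isSome then rank a else k + 1, hx, ?_, ?_⟩, ?_⟩
      · intro a q h
        by_cases hs : (next a).isSome
        · exact h₂ a q (by rw [← hold a hs, h])
        · exact (hnew a q h hs).1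
      · intro a q h
        by_cases hs : (next a).isSome
        · obtain ⟨hp, hk, hq⟩ := h₃ a q (by rw [← hold a hs, h])
          simp only [hs, if_true]
          refine ⟨hp, by omega, hq.imp_right fun ⟨hq, hlt⟩ => ?_⟩
          rw [hold q hq]
          simp [hq, hlt]
        · simp only [hs]
          refine ⟨by simp, by simp, (hnew a q h hs).2.imp_right fun hq => ?_⟩
          rw [hold q hq]
          obtain ⟨q', hq'⟩ := Option.isSome_iff_exists.1 hq
          have := (h₃ q q' hq').2.1
          simp only [hq, if_true]
          exact ⟨trivial, by simp; omega⟩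
      · have himp : (∀ a c, E a c = true → (c = x ∨ (next c).isSome) →
            a = x ∨ (next a).isSome) → next' = next := by
          intro hcl
          funext a
          by_cases h : a = x ∨ (next a).isSome
          · exact (hnext' a).1 h
          · have h' := (hnext' a).2 h
            have : next a = none := by simpa using fun hs => h (Or.inr hs)
            rw [this]
            cases ho : next' a with
            | none => rfl
            | some c =>
              have := h'.2 c ho
              exact absurd (hcl a c this.1 this.2) h
        by_cases hcl : ∀ a c, E a c = true → (c = x ∨ (next c).isSome) → a = x ∨ (next a).isSome
        · rw [himp hcl]
          exact Or.inl hcl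
        · right
          have hk := hcard.resolve_left hcl
          push Not at hcl
          obtain ⟨a, c, hE, hc, ha, hs⟩ := hcl
          refine Nat.succ_le_of_lt (hk.trans_lt (Finset.card_lt_card ?_))
          rw [Finset.ssubset_iff_of_subset]
          · refine ⟨a, ?_, by simpa using hs⟩
            rw [Finset.mem_filter]
            refine ⟨Finset.mem_univ _, ?_⟩
            by_contra hn
            have := (hnext' a).2 (by rintro (h | h); exacts [ha h, hs h])
            exact this.1 (by simpa using hn) c ⟨hE, hc⟩
          · intro d hd
            rw [Finset.mem_filter] at hd ⊢
            exact ⟨hd.1, by rw [hold d hd.2]; exact hd.2⟩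
  · exact ⟨⟨fun _ => 0, rfl, by simp, by simp⟩, Or.inr (Nat.zero_le _)⟩
  · rintro next ⟨⟨rank, h⟩, hcard⟩
    refine ⟨⟨rank, h⟩, ?_⟩
    have hcl : ∀ a c, E a c = true → (c = x ∨ (next c).isSome) → a = x ∨ (next a).isSome := by
      refine hcard.resolve_right fun hle => ?_
      have hlt : (Finset.univ.filter fun a => (next a).isSome).card
          < (Finset.univ : Finset (Fin n)).card := by
        refine Finset.card_lt_card (Finset.filter_ssubset.2 ⟨x, Finset.mem_univ _, ?_⟩)
        simp [h.target]
      rw [Finset.card_fin] at hlt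
      omega
    intro a ha
    induction ha using Relation.ReflTransGen.head_induction_on with
    | refl => exact Or.inl rfl
    | head h _ ih => exact hcl _ _ h ih

def reshuffleCost {R : Type} [CommSemiring R] (x : R) : R :=
  nextTowardsCost x + (1 + (x * (1 + 1) + 1))

/-- Moving the agents along a cycle composes the assignment with a permutation of the rooms. -/
theorem reshuffle_spec {n : ℕ} {E : Graph n} (occ : Room n → Agent n) {x c : Room n}
    (hE : E x c = true) (hreach : E.Reach c x) :
    (reshuffle E occ x c).Spec (reshuffleCost n) fun occ' => ∃ π : Equiv.Perm (Room n),
      occ' = occ ∘ π.symm ∧ π x = c ∧ ∀ a, π a = a ∨ E a (π a) = true := by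
  refine (nextTowards_spec E x).bind ?_
  rintro next ⟨⟨rank, hx, hedge, hdec⟩, hnext⟩
  refine (op_spec _).bind ?_
  rintro _ rfl
  -- Invariant: `π` closes the path walked so far by sending its end `s.2` back to `x`. This closing
  -- jump need not be an edge, and room `x` still holds its old occupant in the array. Ranks fall
  -- along the path, so it meets no room twice and arrives at `x` within `n` rounds.
  refine (forLoop_spec (T := 1) (fun k s => (s.2 = x ∨ (next s.2).isSome ∧ rank s.2 + k ≤ n) ∧
    ∃ π : Equiv.Perm (Room n), π x = c ∧ (s.2 ≠ x → π s.2 = x) ∧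
      (s.1 = if s.2 = x then occ ∘ π.symm else Function.update (occ ∘ π.symm) x (occ x)) ∧
      (∀ a, π a = a ∨ E a (π a) = true ∨ (a = s.2 ∧ s.2 ≠ x)) ∧
      ∀ a, π a ≠ a → s.2 ≠ x → a = x ∨ ((next a).isSome ∧ rank s.2 ≤ rank a)) ?_ ?_).bind ?_
  · rintro k ⟨occ₁, q⟩ ⟨hq, π, hπx, hπq, hocc, hπ, hmoved⟩
    dsimp only at hq hπq hocc hπ hmoved ⊢
    by_cases hqx : q = x
    · rw [if_pos hqx]
      exact op_spec' ⟨Or.inl hqx, π, hπx, hπq, hocc, hπ, hmoved⟩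
    rw [if_neg hqx]
    obtain ⟨hs, hk⟩ := hq.resolve_left hqx
    replace hπq := hπq hqx
    obtain ⟨q', hq'⟩ := Option.isSome_iff_exists.1 hs
    rw [hq']
    obtain ⟨hpos, hle, hlt⟩ := hdec q q' hq'
    refine op_spec' ⟨?_, ?_⟩
    · refine hlt.imp_right fun h => ⟨h.1, ?_⟩
      dsimp only
      omega
    dsimp only
    rw [if_neg hqx] at hocc
    by_cases hqx' : q' = x
    · subst hqx'
      have hsymm : π.symm q' = q := by rw [← hπq, Equiv.symm_apply_apply]
      refine ⟨π, hπx, by simp, ?_, ?_, by simp⟩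
      · rw [if_pos rfl, hocc]
        funext j
        by_cases hj : j = q'
        · subst hj; simp [hsymm]
        · simp [hj]
      · intro a
        rcases hπ a with h | h | ⟨rfl, h⟩
        · exact Or.inl h
        · exact Or.inr (Or.inl h)
        · exact Or.inr (Or.inl (by rw [hπq]; exact hedge _ _ hq'))
    · obtain ⟨hs', hlt⟩ := hlt.resolve_left hqx'
      have hfix : π q' = q' := by
        by_contra h
        rcases hmoved q' h hqx with h | ⟨_, h⟩
        · exact hqx' h
        · omega
      have hqq' : q ≠ q' := by rintro rfl; omega
      have hcx : c ≠ x := by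
        rintro rfl
        exact hqx (π.injective (hπq.trans hπx.symm))
      have hcq' : c ≠ q' := by
        rintro rfl
        exact hqx' (π.injective (hfix.trans hπx.symm))
      -- The swap inserts `q'` into the cycle between `q` and `x`.
      refine ⟨π.trans (Equiv.swap x q'), ?_, ?_, ?_, ?_, ?_⟩
      · simp [hπx, Equiv.swap_apply_of_ne_of_ne hcx hcq']
      · simp [hfix]
      · rw [if_neg hqx', hocc]
        funext j
        by_cases hjx : j = x
        · subst hjx
          simp [Function.update_of_ne (Ne.symm hqx')]
        by_cases hjq : j = q'
        · subst hjq
          have : π.symm x = q := by rw [← hπq, Equiv.symm_apply_apply]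
          simp [hjx, this]
        · simp [hjx, hjq, Equiv.swap_apply_of_ne_of_ne hjx hjq]
      · intro a
        by_cases haq : a = q
        · subst haq
          right; left
          simp [hπq, hedge _ _ hq']
        by_cases haq' : a = q'
        · exact Or.inr (Or.inr ⟨haq', hqx'⟩)
        · have h₁ : π a ≠ x := fun h => haq (π.injective (h.trans hπq.symm))
          have h₂ : π a ≠ q' := fun h => haq' (π.injective (h.trans hfix.symm))
          rcases hπ a with h | h | h
          · left
            rw [Equiv.trans_apply, Equiv.swap_apply_of_ne_of_ne h₁ h₂, h]
          · right; left; simp [Equiv.swap_apply_of_ne_of_ne h₁ h₂, h]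
          · exact absurd h.1 haq
      · intro a ha _
        by_cases haq : a = q'
        · subst haq; exact Or.inr ⟨hs', le_rfl⟩
        · by_cases haq : a = q
          · subst haq
            exact Or.inr ⟨hs, hlt.le⟩
          have h₁ : π a ≠ x := fun h => haq (π.injective (h.trans hπq.symm))
          have h₂ : π a ≠ q' := fun h => by simp_all [π.injective (h.trans hfix.symm)]
          have : π a ≠ a := by simpa [Equiv.swap_apply_of_ne_of_ne h₁ h₂] using ha
          exact (hmoved a this hqx).imp_right fun h => ⟨h.1, by omega⟩
  · by_cases hcx : c = x
    · subst hcx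
      exact ⟨Or.inl rfl, 1, by simp, by simp, by simp [Equiv.Perm.one_def], by simp, by simp⟩
    · refine ⟨?_, Equiv.swap x c, by simp, by simp, ?_, ?_, ?_⟩
      · have hs := (hnext c hreach).resolve_left hcx
        obtain ⟨q, hq⟩ := Option.isSome_iff_exists.1 hs
        have := hdec c q hq
        exact Or.inr ⟨hs, by dsimp only; omega⟩
      · rw [if_neg hcx]
        funext j
        by_cases hjx : j = x
        · subst hjx; simp [Function.update_of_ne (Ne.symm hcx)]
        by_cases hjc : j = c
        · subst hjc; simp [hjx]
        · simp [hjx, hjc, Equiv.swap_apply_of_ne_of_ne hjx hjc]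
      · intro a
        by_cases hax : a = x
        · subst hax; simp [hE]
        by_cases hac : a = c
        · exact Or.inr (Or.inr ⟨hac, hcx⟩)
        · exact Or.inl (Equiv.swap_apply_of_ne_of_ne hax hac)
      · intro a ha _
        by_cases hax : a = x
        · exact Or.inl hax
        by_cases hac : a = c
        · subst hac
          exact Or.inr ⟨(hnext a hreach).resolve_left hcx, le_rfl⟩
        · exact absurd (Equiv.swap_apply_of_ne_of_ne hax hac) ha
  · rintro ⟨occ', q⟩ ⟨hq, π, hπx, -, hocc, hπ, -⟩
    dsimp only at hq hocc hπ
    have hqx : q = x := by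
      refine hq.resolve_right fun ⟨hs, hle⟩ => ?_
      obtain ⟨q', hq'⟩ := Option.isSome_iff_exists.1 hs
      have := (hdec q q' hq').1
      omega
    rw [if_pos hqx] at hocc
    refine op_spec' ⟨π, hocc, hπx, fun a => ?_⟩
    rcases hπ a with h | h | h
    · exact Or.inl h
    · exact Or.inr h
    · exact absurd hqx h.2

/-! ### Envy graphs and continuous changes of the rents -/

/-- The envy graph, as a value. -/
abbrev weakEnvy {n : ℕ} (V : Agent n → Room n → ℝ) (occ : Room n → Agent n) (r : Room n → ℝ) :
    Graph n :=
  fun a c => decide (0 ≤ envy V occ r a c)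

theorem envyGraph_spec {n : ℕ} (V : Agent n → Room n → ℝ) (occ : Room n → Agent n)
    (r : Room n → ℝ) :
    (envyGraph V occ r).Spec (n * (n * 2 + 1)) (· = weakEnvy V occ r) :=
  tabulate_tabulate_op_spec _

theorem envy_self {n : ℕ} (V : Agent n → Room n → ℝ) (occ : Room n → Agent n) (r : Room n → ℝ)
    (a : Room n) : envy V occ r a a = 0 :=
  sub_self _

theorem envy_add_mul {n : ℕ} (V : Agent n → Room n → ℝ) (occ : Room n → Agent n)
    (r d : Room n → ℝ) (t : ℝ) (a c : Room n) :
    envy V occ (fun j => r j + t * d j) a c = envy V occ r a c - t * (d c - d a) := by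
  unfold envy; ring

/-- The agent that moved from `a` to `π a` measures envy against a utility that grew by what the
move gained. -/
theorem envy_comp_symm {n : ℕ} (V : Agent n → Room n → ℝ) (occ : Room n → Agent n)
    (r : Room n → ℝ) (π : Equiv.Perm (Room n)) (a c : Room n) :
    envy V (occ ∘ π.symm) r (π a) c = envy V occ r a c - envy V occ r a (π a) := by
  simp [envy]

theorem hitTime_eq_some {gap rate t : ℝ} :
    hitTime gap rate = some t ↔ rate ≠ 0 ∧ 0 < gap / rate ∧ t = gap / rate := by
  unfold hitTime
  split_ifs with h
  · simp [h.1, h.2, eq_comm]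
  · simp only [false_iff]
    tauto

theorem hitTime_pos {gap rate t : ℝ} (h : hitTime gap rate = some t) : 0 < t := by
  obtain ⟨-, h', rfl⟩ := hitTime_eq_some.1 h
  exact h'

theorem hitTime_hit {gap rate t : ℝ} (h : hitTime gap rate = some t) : gap - t * rate = 0 := by
  obtain ⟨h, -, rfl⟩ := hitTime_eq_some.1 h
  field_simp
  simp

theorem hitTime_gap_ne {gap rate t : ℝ} (h : hitTime gap rate = some t) : gap ≠ 0 := by
  rintro rfl
  have := (hitTime_eq_some.1 h).2.1
  simp at this

theorem hitTime_rate_neg {gap rate t : ℝ} (h : hitTime gap rate = some t) (hg : gap < 0) :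
    rate < 0 := by
  by_contra hr
  have := (hitTime_eq_some.1 h).2.1
  exact absurd (div_nonpos_of_nonpos_of_nonneg hg.le (not_lt.1 hr)) (not_le.2 this)

theorem hitTime_rate_pos {gap rate t : ℝ} (h : hitTime gap rate = some t) (hg : 0 < gap) :
    0 < rate := by
  by_contra hr
  have := (hitTime_eq_some.1 h).2.1
  exact absurd (div_nonpos_of_nonneg_of_nonpos hg.le (not_lt.1 hr)) (not_le.2 this)

/-- A quantity moving at constant rate cannot cross its target before hitting it. -/
theorem nonneg_of_le_hitTime {gap rate t : ℝ} (h : ∀ s, hitTime gap rate = some s → t ≤ s)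
    (ht : 0 ≤ t) (hg : 0 < gap) : 0 ≤ gap - t * rate := by
  rcases le_or_gt rate 0 with hr | hr
  · nlinarith
  · have := h _ (hitTime_eq_some.2 ⟨hr.ne', div_pos hg hr, rfl⟩)
    rw [le_div_iff₀ hr] at this
    linarith

theorem nonpos_of_le_hitTime {gap rate t : ℝ} (h : ∀ s, hitTime gap rate = some s → t ≤ s)
    (ht : 0 ≤ t) (hg : gap < 0) : gap - t * rate ≤ 0 := by
  rcases le_or_gt 0 rate with hr | hr
  · nlinarith
  · have := h _ (hitTime_eq_some.2 ⟨hr.ne, div_pos_of_neg_of_neg hg hr, rfl⟩)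
    rw [le_div_iff_of_neg hr] at this
    linarith

/-- A nonempty finite family of numbers or missing numbers has a minimum that is present. -/
theorem IsMinimum.exists_eq_some {ι : Type} {f : ι → Option ℝ} {m : Option ℝ}
    (h : IsMinimum f m) {i : ι} {t : ℝ} (hi : f i = some t) :
    ∃ s, m = some s ∧ s ≤ t ∧ (∃ j, f j = some s) ∧ ∀ j u, f j = some u → s ≤ u := by
  obtain ⟨s, rfl, hs⟩ := h.1 i t hi
  refine ⟨s, rfl, hs, h.2 s rfl, fun j u hj => ?_⟩
  obtain ⟨s', hs', hle⟩ := h.1 j u hj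
  rwa [Option.some.inj hs']

theorem nextWeakEdge_spec {n : ℕ} (V : Agent n → Room n → ℝ) (occ : Room n → Agent n)
    (r d : Room n → ℝ) :
    (nextWeakEdge V occ r d).Spec (n * (n * 3 + 2))
      (IsMinimum fun p : Room n × Room n => hitTime (envy V occ r p.1 p.2) (d p.2 - d p.1)) := by
  refine (minimum_spec fun a => minimum_op_spec _).mono le_rfl ?_
  rintro m ⟨g, hg, hm⟩
  refine ⟨fun ⟨a, c⟩ t ht => ?_, fun s hs => ?_⟩
  · obtain ⟨s, hs, hst⟩ := (hg a).1 c t ht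
    obtain ⟨s', hs', hss'⟩ := hm.1 a s hs
    exact ⟨s', hs', hss'.trans hst⟩
  · obtain ⟨a, ha⟩ := hm.2 s hs
    obtain ⟨c, hc⟩ := (hg a).2 s ha
    exact ⟨(a, c), hc⟩

theorem ratesUnitUp_spec {n : ℕ} (up down : Room n → Bool) :
    (ratesUnitUp up down).Spec (n * 2 + (n * 2 + n * 2))
      (· = fun j => if up j then 1 else if down j then
        -((∑ i, if up i then (1 : ℝ) else 0) / ∑ i, if down i then (1 : ℝ) else 0) else 0) := by
  refine (countIndices_spec _).bind ?_
  rintro _ rfl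
  refine (countIndices_spec _).bind ?_
  rintro _ rfl
  exact tabulate_op_spec _

theorem ratesUnitDown_spec {n : ℕ} (down up : Room n → Bool) :
    (ratesUnitDown down up).Spec (n * 2 + (n * 2 + n * 2))
      fun d => ∃ ρ : ℝ, 0 ≤ ρ ∧ d = fun j => if down j then -1 else if up j then ρ else 0 := by
  refine (countIndices_spec _).bind ?_
  rintro _ rfl
  refine (countIndices_spec _).bind ?_
  rintro _ rfl
  refine (tabulate_op_spec _).mono le_rfl ?_
  rintro _ rfl
  exact ⟨_, div_nonneg (Finset.sum_nonneg fun _ _ => by split <;> simp)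
    (Finset.sum_nonneg fun _ _ => by split <;> simp), rfl⟩

theorem advance_spec {n : ℕ} (r d : Room n → ℝ) (t : Option ℝ) :
    (advance r d t).Spec (n * 2) (· = fun j => r j + t.getD 0 * d j) :=
  tabulate_op_spec _

/-! ### Klijn's algorithm -/

/-- The strong envy edges. -/
abbrev strongEnvy {n : ℕ} (V : Agent n → Room n → ℝ) (occ : Room n → Agent n) (r : Room n → ℝ) :
    Graph n :=
  fun a c => decide (0 < envy V occ r a c)

/-- The first edge of a graph, by rows. -/
def firstEdge {n : ℕ} (S : Graph n) : Option (Room n × Room n) :=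
  (findFirst fun a => op (findFirst fun c => op (S a c)).val.isSome).val.bind fun i =>
    (findFirst fun c => op (S i c)).val.map fun j => (i, j)

theorem of_firstEdge_eq_some {n : ℕ} {S : Graph n} {i j : Room n}
    (h : firstEdge S = some (i, j)) : S i j = true := by
  unfold firstEdge at h
  simp only [Option.bind_eq_some_iff, Option.map_eq_some_iff, Prod.mk.injEq] at h
  obtain ⟨_, -, _, h, rfl, rfl⟩ := h
  exact (findFirst_op_spec _).2.2 _ h

theorem of_firstEdge_eq_none {n : ℕ} {S : Graph n} (h : firstEdge S = none) (a c : Room n) :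
    S a c = false := by
  by_contra hS
  have h₁ : (findFirst fun c => op (S a c)).val ≠ none := fun hn =>
    hS ((findFirst_op_spec _).2.1 hn c)
  unfold firstEdge at h
  cases hi : (findFirst fun a => op (findFirst fun c => op (S a c)).val.isSome).val with
  | none =>
    have := (findFirst_op_spec _).2.1 hi a
    simp_all
  | some i =>
    have := (findFirst_op_spec _).2.2 i hi
    rw [hi] at h
    simp_all

/-- The number of edges of a graph. -/
def numEdges {n : ℕ} (S : Graph n) : ℕ :=
  (Finset.univ.filter fun p : Room n × Room n => S p.1 p.2 = true).card

theorem numEdges_le {n : ℕ} (S : Graph n) : numEdges S ≤ n * n := by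
  refine (Finset.card_filter_le _ _).trans ?_
  simp

open Classical in
/-- The number of rooms that can reach `i`, plus the number of rooms that `j` can reach. -/
def reachCount {n : ℕ} (E : Graph n) (i j : Room n) : ℕ :=
  (Finset.univ.filter fun a => E.Reach a i).card + (Finset.univ.filter fun a => E.Reach j a).card

theorem reachCount_le {n : ℕ} (E : Graph n) (i j : Room n) : reachCount E i j ≤ 2 * n := by
  classical
  have h₁ := Finset.card_filter_le (Finset.univ : Finset (Room n)) fun a => E.Reach a i
  have h₂ := Finset.card_filter_le (Finset.univ : Finset (Room n)) fun a => E.Reach j a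
  rw [Finset.card_fin] at h₁ h₂
  rw [two_mul]
  unfold reachCount
  convert Nat.add_le_add h₁ h₂

theorem reachCount_lt {n : ℕ} {E E' : Graph n} {i j : Room n}
    (h₁ : ∀ a, E.Reach a i → E'.Reach a i) (h₂ : ∀ a, E.Reach j a → E'.Reach j a)
    (h : ∃ a, (E'.Reach a i ∧ ¬ E.Reach a i) ∨ (E'.Reach j a ∧ ¬ E.Reach j a)) :
    reachCount E i j < reachCount E' i j := by
  classical
  have s₁ : (Finset.univ.filter fun a => E.Reach a i) ⊆ Finset.univ.filter fun a => E'.Reach a i :=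
    fun a => by simpa using h₁ a
  have s₂ : (Finset.univ.filter fun a => E.Reach j a) ⊆ Finset.univ.filter fun a => E'.Reach j a :=
    fun a => by simpa using h₂ a
  unfold reachCount
  obtain ⟨a, h | h⟩ := h
  · have : (Finset.univ.filter fun a => E.Reach a i) ⊂ Finset.univ.filter fun a => E'.Reach a i :=
      (Finset.ssubset_iff_of_subset s₁).2 ⟨a, by simpa using h.1, by simpa using h.2⟩
    convert Nat.add_lt_add_of_lt_of_le (Finset.card_lt_card this) (Finset.card_le_card s₂)
  · have : (Finset.univ.filter fun a => E.Reach j a) ⊂ Finset.univ.filter fun a => E'.Reach j a :=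
      (Finset.ssubset_iff_of_subset s₂).2 ⟨a, by simpa using h.1, by simpa using h.2⟩
    convert Nat.add_lt_add_of_le_of_lt (Finset.card_le_card s₁) (Finset.card_lt_card this)

/-- The potential that decreases in every round of Klijn's algorithm. -/
def klijnPotential {n : ℕ} (V : Agent n → Room n → ℝ) (occ : Room n → Agent n)
    (r : Room n → ℝ) : ℕ :=
  numEdges (strongEnvy V occ r) * (2 * n + 1) +
    (firstEdge (strongEnvy V occ r)).elim 0
      fun p => 2 * n - reachCount (weakEnvy V occ r) p.1 p.2

/-- The reachability part is at most `2 * n`, so with weight `2 * n + 1` one lost strong edge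
outweighs any change of it. -/
theorem klijnPotential_lt {n N : ℕ} (V : Agent n → Room n → ℝ) {occ occ' : Room n → Agent n}
    {r r' : Room n → ℝ}
    (h : numEdges (strongEnvy V occ' r') < numEdges (strongEnvy V occ r)) :
    klijnPotential V occ' r' < numEdges (strongEnvy V occ r) * (2 * n + 1) + N := by
  have h₁ : (firstEdge (strongEnvy V occ' r')).elim 0
      (fun p => 2 * n - reachCount (weakEnvy V occ' r') p.1 p.2) ≤ 2 * n := by
    cases firstEdge (strongEnvy V occ' r') with
    | none => simp
    | some p => simp
  have h₂ := Nat.mul_le_mul_right (2 * n + 1) (Nat.succ_le_of_lt h)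
  rw [Nat.succ_mul] at h₂
  unfold klijnPotential
  omega

/-- Each agent carries its row of strong edges to its new room. No mover loses utility, so rows only
shrink, and the agent leaving `x` loses the edge towards `π x`. -/
theorem numEdges_strongEnvy_reshuffle {n : ℕ} (V : Agent n → Room n → ℝ)
    (occ : Room n → Agent n) (r : Room n → ℝ) (π : Equiv.Perm (Room n))
    (hπ : ∀ a, 0 ≤ envy V occ r a (π a)) {x : Room n} (hx : 0 < envy V occ r x (π x)) :
    numEdges (strongEnvy V (occ ∘ π.symm) r) < numEdges (strongEnvy V occ r) := by
  unfold numEdges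
  -- Re-index the new edges by the old rooms of the agents, so that the two edge sets can be
  -- compared by inclusion.
  rw [← Finset.card_map (Equiv.prodCongr π.symm (Equiv.refl _)).toEmbedding]
  refine Finset.card_lt_card ((Finset.ssubset_iff_of_subset ?_).2 ⟨(x, π x), by simpa using hx, ?_⟩)
  · rintro ⟨a, c⟩ h
    simp only [Finset.mem_map_equiv, Finset.mem_filter, Finset.mem_univ, true_and,
      decide_eq_true_eq, Equiv.prodCongr_symm, Equiv.prodCongr_apply, Prod.map,
      Equiv.symm_symm, Equiv.refl_symm, Equiv.refl_apply, envy_comp_symm] at h ⊢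
    linarith [hπ a]
  · simp only [Finset.mem_map_equiv, Finset.mem_filter, Finset.mem_univ, true_and,
      decide_eq_true_eq, Equiv.prodCongr_symm, Equiv.prodCongr_apply, Prod.map,
      Equiv.symm_symm, Equiv.refl_symm, Equiv.refl_apply, envy_comp_symm]
    simp

/-- The rates satisfy `d a ≤ d c` along every envy edge `a → c`, so no existing envy grows, and no
new strong edge arises up to the first hit. Either the hit removes a strong edge, or it creates a
weak edge that enlarges `R⁻¹(i)` or `R(j)`, whose internal edges all survive because both ends have
the same rate. -/
theorem klijnPotential_rents {n : ℕ} (V : Agent n → Room n → ℝ) (occ : Room n → Agent n)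
    (r d : Room n → ℝ) {i j : Room n} {ρ : ℝ} {down up : Room n → Bool} {t : Option ℝ}
    (hij : firstEdge (strongEnvy V occ r) = some (i, j))
    (hji : ¬ (weakEnvy V occ r).Reach j i)
    (hdown : ∀ a, down a = true ↔ (weakEnvy V occ r).Reach a i)
    (hup : ∀ a, up a = true ↔ (weakEnvy V occ r).Reach j a)
    (hρ : 0 ≤ ρ) (hd : d = fun a => if down a then -1 else if up a then ρ else 0)
    (ht : IsMinimum (fun p : Room n × Room n =>
      hitTime (envy V occ r p.1 p.2) (d p.2 - d p.1)) t) :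
    klijnPotential V occ (fun a => r a + t.getD 0 * d a) < klijnPotential V occ r := by
  have hdisj : ∀ a, down a = true → up a = true → False := fun a h₁ h₂ =>
    hji (((hup a).1 h₂).trans ((hdown a).1 h₁))
  have hdd : ∀ a, down a = true → d a = -1 := fun a h => by simp [hd, h]
  have hdu : ∀ a, up a = true → d a = ρ := fun a h => by
    have : ¬ down a = true := fun h' => hdisj a h' h
    simp [hd, h, this]
  have hdn : ∀ a, ¬ down a = true → ¬ up a = true → d a = 0 := fun a h₁ h₂ => by
    simp [hd, h₁, h₂]
  have hstrong : 0 < envy V occ r i j := by simpa using of_firstEdge_eq_some hij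
  have hedown : ∀ a c, 0 ≤ envy V occ r a c → down c = true → down a = true := fun a c h hc =>
    (hdown a).2 (.head (by simpa using h) ((hdown c).1 hc))
  have heup : ∀ a c, 0 ≤ envy V occ r a c → up a = true → up c = true := fun a c h ha =>
    (hup c).2 (.tail ((hup a).1 ha) (by simpa using h))
  have hmono : ∀ a c, 0 ≤ envy V occ r a c → d a ≤ d c := by
    intro a c h
    by_cases hc : down c = true
    · rw [hdd c hc, hdd a (hedown a c h hc)]
    by_cases hc' : up c = true
    · rw [hdu c hc']
      by_cases ha : down a = true
      · rw [hdd a ha]; linarith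
      by_cases ha' : up a = true
      · rw [hdu a ha']
      · rwa [hdn a ha ha']
    · rw [hdn c hc hc']
      by_cases ha : down a = true
      · rw [hdd a ha]; linarith
      · rw [hdn a ha fun ha' => hc' (heup a c h ha')]
  have hgap : 0 < d j - d i := by
    rw [hdu j ((hup j).2 .refl), hdd i ((hdown i).2 .refl)]
    linarith
  -- The strong edge `i → j` itself shrinks, so a hit time exists and the default `0` is not used.
  obtain ⟨t, rfl, -, ⟨⟨a, c⟩, hac⟩, htmin⟩ := ht.exists_eq_some (i := (i, j))
    (hitTime_eq_some.2 ⟨hgap.ne', div_pos hstrong hgap, rfl⟩)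
  have ht0 := hitTime_pos hac
  rw [Option.getD_some]
  set r' : Room n → ℝ := fun a => r a + t * d a with hr'
  have henvy : ∀ a c, envy V occ r' a c = envy V occ r a c - t * (d c - d a) :=
    envy_add_mul V occ r d t
  have hsub : ∀ a c, 0 < envy V occ r' a c → 0 < envy V occ r a c := by
    intro a c h
    rcases lt_trichotomy (envy V occ r a c) 0 with h' | h' | h'
    · have := nonpos_of_le_hitTime (htmin (a, c)) ht0.le h'
      rw [henvy] at h
      linarith
    · rw [henvy, h'] at h
      nlinarith [hmono a c h'.ge]
    · exact h'
  have hsubset : (Finset.univ.filter fun p : Room n × Room n =>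
      strongEnvy V occ r' p.1 p.2 = true) ⊆
      Finset.univ.filter fun p : Room n × Room n => strongEnvy V occ r p.1 p.2 = true := by
    rintro ⟨a, c⟩ h
    simp only [Finset.mem_filter, Finset.mem_univ, true_and, decide_eq_true_eq] at h ⊢
    exact hsub a c h
  by_cases heq : numEdges (strongEnvy V occ r') < numEdges (strongEnvy V occ r)
  · exact klijnPotential_lt V heq
  have hsame := Finset.eq_of_subset_of_card_le hsubset (not_lt.1 heq)
  -- With the same strong graph, `firstEdge` selects the same pair `(i, j)`, which makes the two
  -- reachability counts comparable.
  have hgraph : strongEnvy V occ r' = strongEnvy V occ r := by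
    funext a c
    have := congrArg (fun s => (a, c) ∈ s) hsame
    simpa using this
  -- If the edge that is hit had been strong, it would have been lost.
  have hne : envy V occ r a c < 0 := by
    refine lt_of_le_of_ne (not_lt.1 fun h => ?_) (hitTime_gap_ne hac)
    have h₁ := congrFun (congrFun hgraph a) c
    have h₂ : envy V occ r' a c = 0 := (henvy a c).trans (hitTime_hit hac)
    simp [h₂, h] at h₁
  have hnew : (weakEnvy V occ r') a c = true := by
    simpa using ((henvy a c).trans (hitTime_hit hac)).ge
  have hrate := hitTime_rate_neg hac hne
  have hkeep : ∀ a c, 0 ≤ envy V occ r a c → d a = d c → weakEnvy V occ r' a c = true := by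
    intro a c h hd
    simpa [henvy, hd] using h
  have hR : ∀ b, (weakEnvy V occ r).Reach b i → (weakEnvy V occ r').Reach b i := by
    intro b hb
    induction hb using Relation.ReflTransGen.head_induction_on with
    | refl => exact .refl
    | head h h' ih =>
      have h₁ := (hdown _).2 h'
      have h₂ := hedown _ _ (of_decide_eq_true h) h₁
      exact .head (hkeep _ _ (of_decide_eq_true h) ((hdd _ h₂).trans (hdd _ h₁).symm)) ih
  have hR' : ∀ b, (weakEnvy V occ r).Reach j b → (weakEnvy V occ r').Reach j b := by
    intro b hb
    induction hb with
    | refl => exact .refl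
    | tail h' h ih =>
      have h₁ := (hup _).2 h'
      have h₂ := heup _ _ (of_decide_eq_true h) h₁
      exact .tail ih (hkeep _ _ (of_decide_eq_true h) ((hdu _ h₁).trans (hdu _ h₂).symm))
  have hlt : reachCount (weakEnvy V occ r) i j < reachCount (weakEnvy V occ r') i j := by
    refine reachCount_lt hR hR' ?_
    -- The negative rate leaves two cases: the new edge enters `R⁻¹(i)` from outside, or it leaves
    -- `R(j)` towards a room of rate `0`.
    by_cases hc : down c = true
    · refine ⟨a, Or.inl ⟨.head hnew (hR c ((hdown c).1 hc)), fun ha => ?_⟩⟩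
      dsimp only at hrate
      rw [hdd c hc, hdd a ((hdown a).2 ha)] at hrate
      linarith
    · by_cases hc' : up c = true
      · exfalso
        dsimp only at hrate
        rw [hdu c hc'] at hrate
        have : d a ≤ ρ := by
          rw [hd]
          dsimp only
          split_ifs <;> linarith
        linarith
      · dsimp only at hrate
        rw [hdn c hc hc'] at hrate
        have ha : up a = true := by
          by_contra ha
          have : d a ≤ 0 := by
            rw [hd]
            dsimp only
            split_ifs <;> norm_num
          linarith
        exact ⟨c, Or.inr ⟨.tail (hR' a ((hup a).1 ha)) hnew, fun h => hc' ((hup c).2 h)⟩⟩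
  have := reachCount_le (weakEnvy V occ r') i j
  unfold klijnPotential
  rw [hgraph, hij]
  simp only [Option.elim_some]
  omega

/-- The costs of alternative branches are added, so each branch is bounded by dropping the others.
-/
def klijnBodyCost {R : Type} [CommSemiring R] (x : R) : R :=
  x * (x * 2 + 1) + (reachCost x + (x * (x * 2 + 1) + (x * (x * 3 + 1) + (x * (x * 3 + 1) +
    (x * 3 + (x * 3 + ((reshuffleCost x + 0) + (x * 2 + (x * 2 + ((x * 2 + (x * 2 + x * 2)) +
      (x * (x * 3 + 2) + (x * 2 + 0))))))))))))

def klijnCost {R : Type} [CommSemiring R] (x : R) : R :=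
  x * 2 + (x * 2 + (x * x * (2 * x + 1) + 2 * x + 1) * (klijnBodyCost x + 1))

/-- Klijn's algorithm computes an envy-free allocation. -/
theorem klijn_spec {n : ℕ} (V : Agent n → Room n → ℝ) :
    (klijn V).Spec (klijnCost n)
      fun p => Function.Bijective p.1 ∧ ∀ a c, envy V p.1 p.2 a c ≤ 0 := by
  unfold klijn
  refine (tabulate_op_spec _).lift.bind ?_
  rintro _ rfl
  refine (tabulate_op_spec _).lift.bind ?_
  rintro _ rfl
  refine whileLoop_spec (fun s => Function.Bijective s.1)
    (fun s => klijnPotential V s.1 s.2) (T := klijnBodyCost n) ?_ Function.bijective_id ?_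
  swap
  · have h₁ := Nat.mul_le_mul_right (2 * n + 1) (numEdges_le (strongEnvy V (fun j => j) fun _ => 0))
    unfold klijnPotential
    refine Nat.add_le_add h₁ ?_
    cases firstEdge (strongEnvy V (fun j => j) fun _ => 0) with
    | none => simp
    | some p => simp
  rintro ⟨occ, r⟩ hocc
  dsimp only
  refine (envyGraph_spec _ _ _).bind ?_
  rintro _ rfl
  refine (reachability_spec _).bind fun M hM => ?_
  refine (tabulate_tabulate_op_spec (fun a c => decide (0 < envy V occ r a c))).bind ?_
  rintro strong hs
  have hstrong : strong = strongEnvy V occ r := hs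
  refine (tabulate_spec fun a => findFirst_op_spec _).bind fun onCycle hon => ?_
  -- The exact value is kept here, not just its specification, in order to identify the chosen pair
  -- with `firstEdge`.
  refine (tabulate_spec fun a => ⟨(findFirst_op_spec _).1, Eq.refl _⟩).bind fun anywhere hany => ?_
  refine (findFirst_op_spec _).bind fun x hx => ?_
  refine Timed.Spec.bind ⟨(findFirst_op_spec _).1, Eq.refl _⟩ fun i hi => ?_
  split
  · rename_i x' c hc
    simp only [Option.bind_eq_some_iff, Option.map_eq_some_iff, Prod.mk.injEq] at hc
    obtain ⟨_, -, _, hc, rfl, rfl⟩ := hc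
    have hc := (hon _).2 _ hc
    rw [Bool.and_eq_true, hM, hstrong, decide_eq_true_eq] at hc
    refine (Timed.Spec.bind (reshuffle_spec occ (decide_eq_true hc.1.le) hc.2) ?_).mono
      (Nat.le_add_right _ _) fun _ h => h
    rintro _ ⟨π, rfl, hπx, hπ⟩
    refine Timed.Spec.pure ⟨fun s' hs' => ?_, by simp⟩
    obtain rfl := Sum.inl.inj hs'
    refine ⟨hocc.comp π.symm.bijective,
      klijnPotential_lt V (numEdges_strongEnvy_reshuffle V occ r π (fun a => ?_) (hπx ▸ hc.1))⟩
    rcases hπ a with h | h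
    · rw [h, envy_self]
    · simpa using h
  · rename_i hnone
    have hcyc : ∀ a c, strong a c = true → ¬ M c a = true := by
      intro a c h₁ h₂
      have h₃ : ∀ y, onCycle y = none := by
        intro y
        cases x with
        | none => simpa using hx.1 rfl y
        | some x =>
          have := hx.2 x rfl
          simp only [Option.bind_some, Option.map_eq_none_iff] at hnone
          simp [hnone] at this
      have := (hon a).1 (h₃ a) c
      simp [h₁, h₂] at this
    refine Timed.Spec.mono (T := n * 2 + (n * 2 + ((n * 2 + (n * 2 + n * 2)) +
      (n * (n * 3 + 2) + (n * 2 + 0))))) ?_ (Nat.le_add_left _ _) fun _ h => h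
    have hfirst : (i.bind fun i => (anywhere i).map fun j => (i, j)) =
        firstEdge (strongEnvy V occ r) := by
      have : anywhere = fun a => (findFirst fun c => op (strong a c)).val :=
        (funext hany).symm
      rw [← hi, this, hstrong]
      rfl
    split
    · rename_i i j hij
      rw [hfirst] at hij
      refine (tabulate_op_spec _).bind ?_
      rintro _ rfl
      refine (tabulate_op_spec _).bind ?_
      rintro _ rfl
      refine (ratesUnitDown_spec _ _).bind ?_
      rintro d ⟨ρ, hρ, hd⟩
      refine (nextWeakEdge_spec _ _ _ _).bind fun t ht => ?_
      refine (advance_spec _ _ _).bind ?_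
      rintro _ rfl
      refine Timed.Spec.pure ⟨fun s' hs' => ?_, by simp⟩
      obtain rfl := Sum.inl.inj hs'
      refine ⟨hocc, klijnPotential_rents V occ r d hij ?_ (fun a => hM a i) (fun a => hM j a)
        hρ hd ht⟩
      rw [← hM]
      exact hcyc i j (by rw [hstrong]; exact of_firstEdge_eq_some hij)
    · rename_i hij
      rw [hfirst] at hij
      refine (Timed.Spec.pure ?_).mono (Nat.zero_le _) fun _ h => h
      refine ⟨by simp, fun p hp => ?_⟩
      obtain rfl := Sum.inr.inj hp
      exact ⟨hocc, fun a c => by simpa using of_firstEdge_eq_none hij a c⟩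

/-! ### Maximum rent in one component -/

/-- The budget-aware envy graph of the subproblem on `C`, as a value. -/
abbrev budgetEnvy {n : ℕ} (V b : Agent n → Room n → ℝ) (C : Room n → Bool)
    (occ : Room n → Agent n) (r : Room n → ℝ) : Graph n :=
  fun a c => C a && C c && decide (0 ≤ envy V occ r a c) && decide (r c < b (occ a) c)

theorem budgetEnvy_eq_true {n : ℕ} {V b : Agent n → Room n → ℝ} {C : Room n → Bool}
    {occ : Room n → Agent n} {r : Room n → ℝ} {a c : Room n} :
    budgetEnvy V b C occ r a c = true ↔
      C a = true ∧ C c = true ∧ 0 ≤ envy V occ r a c ∧ r c < b (occ a) c := by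
  simp [budgetEnvy, and_assoc]

/-- A reassignment of the rooms of `C` along indifferences, with uniformly shifted rents that
respect the budgets. -/
structure IsComponentSolution {n : ℕ} (V b : Agent n → Room n → ℝ) (C : Room n → Bool)
    (occ₀ : Room n → Agent n) (r₀ : Room n → ℝ) (occ : Room n → Agent n) (r : Room n → ℝ)
    (π : Equiv.Perm (Room n)) : Prop where
  fixed : ∀ a, ¬ C a = true → π a = a
  occ_eq : occ = occ₀ ∘ π
  rents : ∃ k, ∀ a, C a = true → r a = r₀ a + k
  indifferent : ∀ a, V (occ a) a - r₀ a = V (occ a) (π a) - r₀ (π a)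
  budget : ∀ a, C a = true → r a ≤ b (occ a) a

namespace IsComponentSolution

variable {n : ℕ} {V b : Agent n → Room n → ℝ} {C : Room n → Bool} {occ₀ occ : Room n → Agent n}
  {r₀ r : Room n → ℝ} {π : Equiv.Perm (Room n)}

theorem mem (h : IsComponentSolution V b C occ₀ r₀ occ r π) {a : Room n} (ha : C a = true) :
    C (π a) = true := by
  by_contra hn
  exact hn (by rwa [π.injective (h.fixed _ hn)])

/-- The occupant of `a` came from `π a` and is indifferent between the two rooms at `r₀`; a common
shift of the rents changes no comparison inside `C`. -/
theorem envy_eq (h : IsComponentSolution V b C occ₀ r₀ occ r π) {a c : Room n}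
    (ha : C a = true) (hc : C c = true) : envy V occ r a c = envy V occ₀ r₀ (π a) c := by
  obtain ⟨k, hk⟩ := h.rents
  have := h.indifferent a
  rw [h.occ_eq, Function.comp_apply] at this
  rw [h.occ_eq]
  unfold envy
  rw [hk a ha, hk c hc]
  simp only [Function.comp_apply]
  linarith

theorem envy_nonpos (h : IsComponentSolution V b C occ₀ r₀ occ r π)
    (hEF : ∀ a c, envy V occ₀ r₀ a c ≤ 0) {a c : Room n} (ha : C a = true) (hc : C c = true) :
    envy V occ r a c ≤ 0 :=
  h.envy_eq ha hc ▸ hEF _ _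

theorem shift (h : IsComponentSolution V b C occ₀ r₀ occ r π) {t : ℝ}
    (ht : ∀ a, C a = true → t ≤ b (occ a) a - r a) :
    IsComponentSolution V b C occ₀ r₀ occ (fun a => if C a = true then r a + t else r a) π := by
  refine ⟨h.fixed, h.occ_eq, ?_, h.indifferent, fun a ha => ?_⟩
  · obtain ⟨k, hk⟩ := h.rents
    exact ⟨k + t, fun a ha => by rw [if_pos ha, hk a ha]; ring⟩
  · rw [if_pos ha]
    linarith [ht a ha]

/-- Without envy inside `C`, an edge of the budget-aware graph is an indifference, and its strict
budget inequality protects the budget of the agent that moves. -/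
theorem reshuffle (h : IsComponentSolution V b C occ₀ r₀ occ r π)
    (hEF : ∀ a c, envy V occ₀ r₀ a c ≤ 0) {ρ : Equiv.Perm (Room n)}
    (hρ : ∀ a, ρ a = a ∨ budgetEnvy V b C occ r a (ρ a) = true) :
    IsComponentSolution V b C occ₀ r₀ (occ ∘ ρ.symm) r (ρ.symm.trans π) := by
  have hval : ∀ a, V (occ a) (ρ a) - r₀ (ρ a) = V (occ a) a - r₀ a := by
    intro a
    rcases hρ a with h' | h'
    · rw [h']
    · obtain ⟨ha, hc, he, -⟩ := budgetEnvy_eq_true.1 h'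
      have := le_antisymm (h.envy_nonpos hEF ha hc) he
      obtain ⟨k, hk⟩ := h.rents
      unfold envy at this
      rw [hk _ ha, hk _ hc] at this
      linarith
  refine ⟨fun a ha => ?_, ?_, h.rents, fun a => ?_, fun a ha => ?_⟩
  · obtain ⟨a, rfl⟩ := ρ.surjective a
    rcases hρ a with h' | h'
    · rw [h'] at ha
      rw [Equiv.trans_apply, Equiv.symm_apply_apply, h', h.fixed a ha]
    · exact absurd (budgetEnvy_eq_true.1 h').2.1 ha
  · rw [h.occ_eq]
    rfl
  · obtain ⟨a, rfl⟩ := ρ.surjective a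
    simp only [Function.comp_apply, Equiv.symm_apply_apply, Equiv.trans_apply]
    rw [hval, h.indifferent]
  · obtain ⟨a, rfl⟩ := ρ.surjective a
    simp only [Function.comp_apply, Equiv.symm_apply_apply]
    rcases hρ a with h' | h'
    · rw [h'] at ha ⊢
      exact h.budget a ha
    · exact (budgetEnvy_eq_true.1 h').2.2.2.le

end IsComponentSolution

/-- The agents whose rents equal their budgets. -/
def numTight {n : ℕ} (b : Agent n → Room n → ℝ) (C : Room n → Bool) (occ : Room n → Agent n)
    (r : Room n → ℝ) : ℕ :=
  (Finset.univ.filter fun a : Room n => C a = true ∧ r a = b (occ a) a).card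

/-- The agents and rooms such that the rent is below the budget. -/
def numBelow {n : ℕ} (b : Agent n → Room n → ℝ) (C : Room n → Bool) (r : Room n → ℝ) : ℕ :=
  (Finset.univ.filter fun p : Agent n × Room n => C p.2 = true ∧ r p.2 < b p.1 p.2).card

theorem numTight_le {n : ℕ} (b : Agent n → Room n → ℝ) (C : Room n → Bool)
    (occ : Room n → Agent n) (r : Room n → ℝ) : numTight b C occ r ≤ n :=
  (Finset.card_filter_le _ _).trans (by simp)

theorem numBelow_le {n : ℕ} (b : Agent n → Room n → ℝ) (C : Room n → Bool) (r : Room n → ℝ) :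
    numBelow b C r ≤ n * n :=
  (Finset.card_filter_le _ _).trans (by simp)

theorem numBelow_shift_lt {n : ℕ} {b : Agent n → Room n → ℝ} {C : Room n → Bool}
    {occ : Room n → Agent n} {r : Room n → ℝ} {t : ℝ} (ht : 0 < t) {x : Room n} (hx : C x = true)
    (hxt : b (occ x) x - r x = t) :
    numBelow b C (fun a => if C a = true then r a + t else r a) < numBelow b C r := by
  refine Finset.card_lt_card ((Finset.ssubset_iff_of_subset ?_).2 ⟨(occ x, x), ?_, ?_⟩)
  · rintro ⟨i, a⟩ h
    simp only [Finset.mem_filter, Finset.mem_univ, true_and] at h ⊢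
    rw [if_pos h.1] at h
    exact ⟨h.1, by linarith [h.2]⟩
  · simp only [Finset.mem_filter, Finset.mem_univ, true_and]
    exact ⟨hx, by linarith⟩
  · simp only [Finset.mem_filter, Finset.mem_univ, true_and, hx, if_true, not_lt]
    linarith

/-- Every agent that moves enters a room where it has slack, so no tight agent is created, while the
one in `x` leaves. -/
theorem numTight_reshuffle_lt {n : ℕ} {V b : Agent n → Room n → ℝ} {C : Room n → Bool}
    {occ : Room n → Agent n} {r : Room n → ℝ} {ρ : Equiv.Perm (Room n)}
    (hρ : ∀ a, ρ a = a ∨ budgetEnvy V b C occ r a (ρ a) = true) {x : Room n}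
    (hxC : C x = true) (hx : r x = b (occ x) x) (hxρ : ρ x ≠ x) :
    numTight b C (occ ∘ ρ.symm) r < numTight b C occ r := by
  have hmoved : ∀ a, r a = b (occ (ρ.symm a)) a → ρ.symm a = a := by
    intro a ha
    obtain ⟨a, rfl⟩ := ρ.surjective a
    rw [Equiv.symm_apply_apply] at ha ⊢
    rcases hρ a with h | h
    · exact h.symm
    · exact absurd ha (budgetEnvy_eq_true.1 h).2.2.2.ne
  refine Finset.card_lt_card ((Finset.ssubset_iff_of_subset ?_).2 ⟨x, ?_, ?_⟩)
  · intro a h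
    simp only [Finset.mem_filter, Finset.mem_univ, true_and, Function.comp_apply] at h ⊢
    rwa [hmoved a h.2] at h
  · simp [hxC, hx]
  · simp only [Finset.mem_filter, Finset.mem_univ, true_and, Function.comp_apply, not_and]
    intro _ h
    exact hxρ ((Equiv.symm_apply_eq ρ).1 (hmoved x h)).symm

theorem minSlack_spec {n : ℕ} (b : Agent n → Room n → ℝ) (C : Room n → Bool)
    (occ : Room n → Agent n) (r : Room n → ℝ) {c : Room n} (hc : C c = true) :
    (minSlack b C occ r).Spec (n * 3) fun m => ∃ t, m = some t ∧
      (∃ x, C x = true ∧ b (occ x) x - r x = t) ∧ ∀ a, C a = true → t ≤ b (occ a) a - r a := by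
  refine (minimum_op_spec _).mono le_rfl fun m hm => ?_
  obtain ⟨t, rfl, -, ⟨x, hx⟩, ht⟩ := hm.exists_eq_some (i := c) (if_pos hc)
  refine ⟨t, rfl, ⟨x, ?_⟩, fun a ha => ht a _ (if_pos ha)⟩
  split_ifs at hx with h
  exact ⟨h, Option.some.inj hx⟩

theorem shiftRents_spec {n : ℕ} (C : Room n → Bool) (r : Room n → ℝ) (t : ℝ) :
    (shiftRents C r (some t)).Spec (n * 2) (· = fun a => if C a = true then r a + t else r a) :=
  tabulate_op_spec _

def sccBodyCost {R : Type} [CommSemiring R] (x : R) : R :=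
  x * (x * 2 + 1) + (reachCost x + (x * 2 + (x * (x * 3 + 1) + ((x * 3 + 1) + (x * 3 +
    ((x * 2 + (x * 2 + 0)) + ((x * 3 + (x * 2 + 0)) + (reshuffleCost x + 0))))))))

def sccCost {R : Type} [CommSemiring R] (x : R) : R :=
  x * 3 + (x * 2 + (x * x * (x + 1) + x + 1) * (sccBodyCost x + 1))

/-- The algorithm on a component stops with a tight agent that lies on no cycle of the budget-aware
envy graph. -/
theorem sccEFRents_spec {n : ℕ} (V b : Agent n → Room n → ℝ) (C : Room n → Bool)
    {occ₀ : Room n → Agent n} {r₀ : Room n → ℝ} (hEF : ∀ a c, envy V occ₀ r₀ a c ≤ 0)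
    {c₀ : Room n} (hc₀ : C c₀ = true) :
    (sccEFRents V b C occ₀ r₀).Spec (sccCost n) fun p => ∃ r π,
      IsComponentSolution V b C occ₀ r₀ p.2.1 r π ∧ ∃ x, C x = true ∧ r x = b (p.2.1 x) x ∧
        ∀ c, budgetEnvy V b C p.2.1 r x c = true → ¬ (budgetEnvy V b C p.2.1 r).Reach c x := by
  unfold sccEFRents
  refine (minSlack_spec b C occ₀ r₀ hc₀).lift.bind ?_
  rintro _ ⟨t, rfl, ⟨x, hx, hxt⟩, ht⟩
  refine (shiftRents_spec _ _ _).lift.bind ?_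
  rintro _ rfl
  refine whileLoop_spec (fun s => ∃ π, IsComponentSolution V b C occ₀ r₀ s.1 s.2 π)
    -- `numBelow` ranges over all agents, not only occupants, so a reshuffle leaves it unchanged.
    -- The weight `n + 1` exceeds any number of tight agents.
    (fun s => numBelow b C s.2 * (n + 1) + numTight b C s.1 s.2) (T := sccBodyCost n) ?_ ?_ ?_
  rotate_left
  · refine ⟨Equiv.refl _, fun _ _ => rfl, rfl, ⟨t, fun a ha => if_pos ha⟩, fun _ => rfl,
      fun a ha => ?_⟩
    dsimp only
    rw [if_pos ha]
    linarith [ht a ha]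
  · exact Nat.add_le_add (Nat.mul_le_mul_right _ (numBelow_le _ _ _)) (numTight_le _ _ _ _)
  clear ht hxt hx x t
  rintro ⟨occ, r⟩ ⟨π, hπ⟩
  dsimp only at hπ ⊢
  refine Timed.Spec.bind (P := (· = budgetEnvy V b C occ r)) (tabulate_tabulate_op_spec _) ?_
  rintro _ rfl
  refine (reachability_spec _).bind fun M hM => ?_
  refine (tabulate_op_spec _).bind ?_
  rintro _ rfl
  refine (tabulate_spec fun a => findFirst_op_spec _).bind fun succ hsucc => ?_
  refine (existsIndex_op_spec _).bind fun stuck hstuck => ?_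
  refine (findFirst_op_spec _).bind fun x hx => ?_
  split_ifs with hst
  · refine Timed.Spec.mono (T := n * 2 + (n * 2 + 0)) ?_ (Nat.le_add_right _ _) fun _ h => h
    refine (tabulate_op_spec _).bind fun _ _ => (sumEntries_spec _).bind fun _ _ => ?_
    refine Timed.Spec.pure ⟨by simp, fun p hp => ?_⟩
    obtain rfl := Sum.inr.inj hp
    obtain ⟨x, hx⟩ := hstuck.1 hst
    simp only [Bool.and_eq_true, decide_eq_true_eq, Option.isNone_iff_eq_none] at hx
    refine ⟨r, π, hπ, x, hx.1.1, hx.1.2, fun c hc hr => ?_⟩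
    have := (hsucc x).1 hx.2 c
    rw [(hM c x).2 hr, Bool.and_true] at this
    exact absurd hc (by rw [this]; simp)
  · refine Timed.Spec.mono (T := (n * 3 + (n * 2 + 0)) + (reshuffleCost n + 0)) ?_
      (Nat.le_add_left _ _) fun _ h => h
    have hnst : ∀ a, C a = true → r a = b (occ a) a → ∃ c, succ a = some c := by
      intro a ha h
      by_contra hn
      refine hst (hstuck.2 ⟨a, ?_⟩)
      simp only [ha, h, Bool.and_eq_true, decide_eq_true_eq, Option.isNone_iff_eq_none, true_and]
      exact Option.eq_none_iff_forall_ne_some.2 (not_exists.1 hn)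
    split
    · have hnt : ∀ a, C a = true → r a ≠ b (occ a) a := fun a ha h => by
        simpa [ha, h] using hx.1 rfl a
      refine Timed.Spec.mono (T := n * 3 + (n * 2 + 0)) ?_ (Nat.le_add_right _ _) fun _ h => h
      refine (minSlack_spec b C occ r hc₀).bind ?_
      rintro _ ⟨t, rfl, ⟨x, hx, hxt⟩, ht⟩
      refine (shiftRents_spec _ _ _).bind ?_
      rintro _ rfl
      refine Timed.Spec.pure ⟨fun s' hs' => ?_, by simp⟩
      obtain rfl := Sum.inl.inj hs'
      refine ⟨⟨π, hπ.shift ht⟩, ?_⟩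
      have ht0 : 0 < t := by
        have := lt_of_le_of_ne (hπ.budget x hx) (hnt x hx)
        linarith
      have h₁ := Nat.mul_le_mul_right (n + 1)
        (Nat.succ_le_of_lt (numBelow_shift_lt (b := b) ht0 hx hxt))
      have h₂ := numTight_le b C occ fun a => if C a = true then r a + t else r a
      rw [Nat.succ_mul] at h₁
      dsimp only
      omega
    · rename_i x
      have hxt := hx.2 x rfl
      rw [Bool.and_eq_true, decide_eq_true_eq] at hxt
      obtain ⟨c, hc⟩ := hnst x hxt.1 hxt.2
      rw [hc]
      have hcyc := (hsucc x).2 c hc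
      rw [Bool.and_eq_true, hM] at hcyc
      refine Timed.Spec.mono (T := reshuffleCost n + 0) ?_ (Nat.le_add_left _ _) fun _ h => h
      refine (reshuffle_spec occ hcyc.1 hcyc.2).bind ?_
      rintro _ ⟨ρ, rfl, hρx, hρ⟩
      refine Timed.Spec.pure ⟨fun s' hs' => ?_, by simp⟩
      obtain rfl := Sum.inl.inj hs'
      refine ⟨⟨_, hπ.reshuffle hEF hρ⟩, ?_⟩
      refine Nat.add_lt_add_left (numTight_reshuffle_lt hρ hxt.1 hxt.2 ?_) _
      -- A tight room has no loop in the budget-aware graph, so its occupant really moves.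
      rw [hρx]
      rintro rfl
      exact absurd hxt.2 (budgetEnvy_eq_true.1 hcyc.1).2.2.2.ne

/-! ### Comparison with an envy-free allocation that respects the budgets -/

/-- The orbit of `x` under a permutation of finite order returns to `x`. -/
theorem reach_of_perm {n : ℕ} {E : Graph n} {C : Room n → Prop} {τ : Equiv.Perm (Room n)}
    (hτ : ∀ a, C a → C (τ a) ∧ E a (τ a) = true) {x : Room n} (hx : C x) : E.Reach (τ x) x := by
  have key : ∀ m y, C y → E.Reach y ((τ ^ m) y) := by
    intro m
    induction m with
    | zero => intro y _; exact .refl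
    | succ m ih =>
      intro y hy
      rw [pow_succ, Equiv.Perm.mul_apply]
      exact .head (hτ y hy).2 (ih _ (hτ y hy).1)
  have h := key (orderOf τ - 1) (τ x) (hτ x hx).1
  rwa [← Equiv.Perm.mul_apply, ← pow_succ, Nat.sub_add_cancel (orderOf_pos τ), pow_orderOf_eq_one,
    Equiv.Perm.one_apply] at h

section Compare

variable {n : ℕ} {V b : Agent n → Room n → ℝ} {e : Room n ≃ Agent n} {r₀ s : Room n → ℝ}
  {σ : Agent n ≃ Room n}

/-- Since `σ ∘ e` permutes the rooms, rents cancel in the sum of the envies, which is the same for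
`r₀` and `s`. Its terms are nonpositive at `r₀` and nonnegative at `s`, so all of them vanish. -/
theorem optimal_of_envyFree (hEF : ∀ a c, envy V e r₀ a c ≤ 0)
    (hs : ∀ i j, V i j - s j ≤ V i (σ i) - s (σ i)) :
    (∀ a, envy V e r₀ a (σ (e a)) = 0) ∧ ∀ a, envy V e s a (σ (e a)) = 0 := by
  have h₁ : ∀ a, envy V e r₀ a (σ (e a)) ≤ 0 := fun a => hEF _ _
  have h₂ : ∀ a, 0 ≤ envy V e s a (σ (e a)) := fun a => sub_nonneg.2 (hs _ _)
  have hsum : ∀ q : Room n → ℝ, ∑ a, q (σ (e a)) = ∑ a, q a := fun q =>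
    Equiv.sum_comp (e.trans σ) q
  have heq : ∑ a, envy V e r₀ a (σ (e a)) = ∑ a, envy V e s a (σ (e a)) := by
    simp only [envy, Finset.sum_sub_distrib, hsum]
    ring
  have h₃ := Finset.sum_nonpos fun a (_ : a ∈ Finset.univ) => h₁ a
  have h₄ := Finset.sum_nonneg fun a (_ : a ∈ Finset.univ) => h₂ a
  refine ⟨fun a => ?_, fun a => ?_⟩
  · exact (Finset.sum_eq_zero_iff_of_nonpos fun a _ => h₁ a).1 (by linarith) a (Finset.mem_univ a)
  · exact (Finset.sum_eq_zero_iff_of_nonneg fun a _ => h₂ a).1 (by linarith) a (Finset.mem_univ a)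

/-- At rents `s` the occupant of `a` is indifferent between `a` and its room under `σ`, which is
optimal for it. -/
theorem envy_nonpos_of_envyFree (hEF : ∀ a c, envy V e r₀ a c ≤ 0)
    (hs : ∀ i j, V i j - s j ≤ V i (σ i) - s (σ i)) (a c : Room n) : envy V e s a c ≤ 0 := by
  have h₁ := (optimal_of_envyFree hEF hs).2 a
  have h₂ := hs (e a) c
  unfold envy at h₁ ⊢
  linarith

/-- Along an edge `a → c`, the occupant's value difference is at least the rent difference in `r₀`
and at most that in `s`. -/
theorem sub_le_sub_of_reach {occ : Room n → Agent n} (hs : ∀ a c, envy V occ s a c ≤ 0)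
    {a c : Room n} (h : (weakEnvy V occ r₀).Reach a c) : s a - r₀ a ≤ s c - r₀ c := by
  induction h with
  | refl => exact le_rfl
  | @tail c d _ h ih =>
    have h₁ := of_decide_eq_true h
    have h₂ := hs c d
    unfold envy at h₁ h₂
    linarith

/-- In fact `s ≤ r` on `C`. Both differ from `r₀` by a constant there, so otherwise `r < s`
throughout `C`. Then every agent of `C` has slack at rents `r` in its room under `σ`, and moving all
of them there puts `x` on a cycle. -/
theorem IsComponentSolution.le_budget {C : Room n → Bool} {occ : Room n → Agent n}
    {r : Room n → ℝ} {π : Equiv.Perm (Room n)}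
    (h : IsComponentSolution V b C e r₀ occ r π) (hEF : ∀ a c, envy V e r₀ a c ≤ 0)
    (hs : ∀ i j, V i j - s j ≤ V i (σ i) - s (σ i)) (hb : ∀ i, s (σ i) ≤ b i (σ i))
    {c₀ : Room n} (hC : ∀ a, C a = true ↔
      (weakEnvy V e r₀).Reach c₀ a ∧ (weakEnvy V e r₀).Reach a c₀)
    {x : Room n} (hx : C x = true)
    (hstuck : ∀ c, budgetEnvy V b C occ r x c = true → ¬ (budgetEnvy V b C occ r).Reach c x)
    {y : Room n} (hy : C y = true) : s y ≤ b (occ y) y := by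
  refine le_trans ?_ (h.budget y hy)
  by_contra! hlt
  have hopt := optimal_of_envyFree hEF hs
  have hsEF := envy_nonpos_of_envyFree hEF hs
  have hsame : ∀ a, C a = true → s a - r₀ a = s c₀ - r₀ c₀ := fun a ha =>
    le_antisymm (sub_le_sub_of_reach hsEF ((hC a).1 ha).2)
      (sub_le_sub_of_reach hsEF ((hC a).1 ha).1)
  have hgt : ∀ a, C a = true → r a < s a := by
    intro a ha
    obtain ⟨k, hk⟩ := h.rents
    rw [hk y hy] at hlt
    rw [hk a ha]
    linarith [hsame a ha, hsame y hy]
  let τ₀ : Equiv.Perm (Room n) := e.trans σ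
  -- `τ₀` follows envy edges and its orbits are cycles, so it preserves strongly connected
  -- components.
  have hτ₀ : ∀ a, C a = true → C (τ₀ a) = true := by
    intro a ha
    have hE : ∀ d, weakEnvy V e r₀ d (τ₀ d) = true := fun d => by simp [τ₀, hopt.1 d]
    rw [hC] at ha ⊢
    exact ⟨.tail ha.1 (hE a),
      (reach_of_perm (C := fun _ => True) (fun d _ => ⟨trivial, hE d⟩) trivial).trans ha.2⟩
  let τ : Equiv.Perm (Room n) := π.trans τ₀
  have hτ : ∀ a, C a = true → C (τ a) = true ∧ budgetEnvy V b C occ r a (τ a) = true := by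
    intro a ha
    have hm : C (τ a) = true := hτ₀ _ (h.mem ha)
    refine ⟨hm, budgetEnvy_eq_true.2 ⟨ha, hm, ?_, ?_⟩⟩
    · rw [h.envy_eq ha hm]
      exact (hopt.1 (π a)).ge
    · refine (hgt _ hm).trans_le ?_
      have := hb (occ a)
      rwa [h.occ_eq] at this ⊢
  exact hstuck _ (hτ x hx).2 (reach_of_perm hτ hx)

end Compare

/-! ### Envy-free rents within upper bounds -/

theorem IsMinimum.minOption {ι κ : Type} {f : ι → Option ℝ} {g : κ → Option ℝ}
    {x y : Option ℝ} (hx : IsMinimum f x) (hy : IsMinimum g y) :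
    IsMinimum (Sum.elim f g) (minOption x y) := by
  cases x with
  | none =>
    refine ⟨?_, fun s hs => ?_⟩
    · rintro (i | i) t ht
      · obtain ⟨_, h, -⟩ := hx.1 i t ht
        cases h
      · exact hy.1 i t ht
    · obtain ⟨i, hi⟩ := hy.2 s hs
      exact ⟨Sum.inr i, hi⟩
  | some x =>
    cases y with
    | none =>
      refine ⟨?_, fun s hs => ?_⟩
      · rintro (i | i) t ht
        · exact hx.1 i t ht
        · obtain ⟨_, h, -⟩ := hy.1 i t ht
          cases h
      · obtain ⟨i, hi⟩ := hx.2 s hs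
        exact ⟨Sum.inl i, hi⟩
    | some y =>
      refine ⟨fun i t ht => ⟨_, rfl, ?_⟩, fun s hs => ?_⟩
      · rcases i with i | i
        · obtain ⟨s, h, hs⟩ := hx.1 i t ht
          obtain rfl := Option.some.inj h
          split_ifs <;> linarith
        · obtain ⟨s, h, hs⟩ := hy.1 i t ht
          obtain rfl := Option.some.inj h
          split_ifs <;> linarith
      · obtain rfl := Option.some.inj hs
        split_ifs
        · obtain ⟨i, hi⟩ := hx.2 x rfl
          exact ⟨Sum.inl i, hi⟩
        · obtain ⟨i, hi⟩ := hy.2 y rfl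
          exact ⟨Sum.inr i, hi⟩

section Bounds

variable {n : ℕ} (V : Agent n → Room n → ℝ) (occ : Room n → Agent n) (u r : Room n → ℝ)

/-- The room can reach a room with rent above its bound. -/
def ReachesAbove (a : Room n) : Prop := ∃ c, u c < r c ∧ (weakEnvy V occ r).Reach a c

/-- The room can reach a room with rent above or at its bound. -/
def ReachesBound (a : Room n) : Prop := ∃ c, u c ≤ r c ∧ (weakEnvy V occ r).Reach a c

/-- The number of rooms with rent above the bound. -/
def numAbove : ℕ := (Finset.univ.filter fun j => u j < r j).card

open Classical in
/-- The number of rooms that can reach a room above its bound, plus the number of those that can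
reach a room above or at its bound. -/
def boundsReachCount : ℕ :=
  (Finset.univ.filter (ReachesAbove V occ u r)).card +
    (Finset.univ.filter (ReachesBound V occ u r)).card

/-- The potential that decreases in every round of the bounds algorithm. -/
def boundsPotential : ℕ :=
  numAbove u r * (2 * n + 1) + (2 * n - boundsReachCount V occ u r)

theorem boundsReachCount_le : boundsReachCount V occ u r ≤ 2 * n := by
  classical
  have h₁ := Finset.card_filter_le (Finset.univ : Finset (Room n)) (ReachesAbove V occ u r)
  have h₂ := Finset.card_filter_le (Finset.univ : Finset (Room n)) (ReachesBound V occ u r)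
  rw [Finset.card_fin] at h₁ h₂
  rw [two_mul]
  unfold boundsReachCount
  convert Nat.add_le_add h₁ h₂

theorem boundsPotential_le : boundsPotential V occ u r ≤ n * (2 * n + 1) + 2 * n := by
  have h₁ : numAbove u r ≤ n := (Finset.card_filter_le _ _).trans (by simp)
  exact Nat.add_le_add (Nat.mul_le_mul_right _ h₁) (Nat.sub_le _ _)

variable {V occ u r}

theorem ReachesAbove.reachesBound {a : Room n} (h : ReachesAbove V occ u r a) :
    ReachesBound V occ u r a :=
  let ⟨c, hc, hr⟩ := h
  ⟨c, hc.le, hr⟩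

theorem boundsReachCount_lt {r' : Room n → ℝ}
    (h₁ : ∀ a, ReachesAbove V occ u r a → ReachesAbove V occ u r' a)
    (h₂ : ∀ a, ReachesBound V occ u r a → ReachesBound V occ u r' a)
    (h : ∃ a, (ReachesAbove V occ u r' a ∧ ¬ ReachesAbove V occ u r a) ∨
      (ReachesBound V occ u r' a ∧ ¬ ReachesBound V occ u r a)) :
    boundsReachCount V occ u r < boundsReachCount V occ u r' := by
  classical
  have s₁ : Finset.univ.filter (ReachesAbove V occ u r) ⊆
      Finset.univ.filter (ReachesAbove V occ u r') := fun a => by simpa using h₁ a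
  have s₂ : Finset.univ.filter (ReachesBound V occ u r) ⊆
      Finset.univ.filter (ReachesBound V occ u r') := fun a => by simpa using h₂ a
  unfold boundsReachCount
  obtain ⟨a, h | h⟩ := h
  · have : Finset.univ.filter (ReachesAbove V occ u r) ⊂
        Finset.univ.filter (ReachesAbove V occ u r') :=
      (Finset.ssubset_iff_of_subset s₁).2 ⟨a, by simpa using h.1, by simpa using h.2⟩
    convert Nat.add_lt_add_of_lt_of_le (Finset.card_lt_card this) (Finset.card_le_card s₂)
  · have : Finset.univ.filter (ReachesBound V occ u r) ⊂
        Finset.univ.filter (ReachesBound V occ u r') :=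
      (Finset.ssubset_iff_of_subset s₂).2 ⟨a, by simpa using h.1, by simpa using h.2⟩
    convert Nat.add_lt_add_of_le_of_lt (Finset.card_le_card s₁) (Finset.card_lt_card this)

theorem sum_ite_pos {p : Room n → Bool} (h : ∃ j, p j = true) :
    0 < ∑ i, if p i = true then (1 : ℝ) else 0 := by
  obtain ⟨j, hj⟩ := h
  exact Finset.sum_pos' (fun _ _ => by split <;> simp) ⟨j, Finset.mem_univ _, by simp [hj]⟩

/-- Rates do not decrease along envy edges, so envy-freeness survives up to the first hit, and no
room newly exceeds its bound. If the rooms above their bounds stay the same, both reachability sets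
persist and one grows: a new edge enters `dec`, or leads from `inc` to a room that reaches a bound,
or a room of `inc` arrives at its bound. -/
theorem bounds_step {inc dec : Room n → Bool} {d : Room n → ℝ} {t : Option ℝ}
    (hEF : ∀ a c, envy V occ r a c ≤ 0)
    (hdec : ∀ a, dec a = true ↔ ReachesAbove V occ u r a)
    (hinc : ∀ a, inc a = true ↔ ¬ ReachesBound V occ u r a)
    (habove : ∃ j, u j < r j) (hany : ∃ j, inc j = true)
    (hd : d = fun j => if inc j = true then 1 else if dec j = true then
        -((∑ i, if inc i = true then (1 : ℝ) else 0) / ∑ i, if dec i = true then (1 : ℝ) else 0)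
      else 0)
    (ht : IsMinimum (Sum.elim
      (fun p : Room n × Room n => hitTime (envy V occ r p.1 p.2) (d p.2 - d p.1))
      fun j => hitTime (u j - r j) (d j)) t) :
    (∀ a c, envy V occ (fun j => r j + t.getD 0 * d j) a c ≤ 0) ∧
      ∑ j, (r j + t.getD 0 * d j) = ∑ j, r j ∧
      boundsPotential V occ u (fun j => r j + t.getD 0 * d j) < boundsPotential V occ u r := by
  obtain ⟨j₀, hj₀⟩ := habove
  have hdecj₀ : dec j₀ = true := (hdec _).2 ⟨j₀, hj₀, .refl⟩
  have hp := sum_ite_pos hany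
  have hq := sum_ite_pos ⟨j₀, hdecj₀⟩
  have hρ := div_pos hp hq
  have hdisj : ∀ a, inc a = true → dec a = true → False := fun a h₁ h₂ =>
    (hinc a).1 h₁ ((hdec a).1 h₂).reachesBound
  have hsum : ∑ j, d j = 0 := by
    have : ∀ j, d j = (if inc j = true then (1 : ℝ) else 0) -
        ((∑ i, if inc i = true then (1 : ℝ) else 0) /
          ∑ i, if dec i = true then (1 : ℝ) else 0) * if dec j = true then 1 else 0 := by
      intro j
      rw [hd]
      have := hdisj j
      by_cases h₁ : inc j = true <;> by_cases h₂ : dec j = true <;> simp_all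
    rw [Finset.sum_congr rfl fun j _ => this j, Finset.sum_sub_distrib, ← Finset.mul_sum,
      div_mul_cancel₀ _ hq.ne', sub_self]
  set ρ : ℝ := (∑ i, if inc i = true then (1 : ℝ) else 0) /
    ∑ i, if dec i = true then (1 : ℝ) else 0
  have hdi : ∀ a, inc a = true → d a = 1 := fun a h => by simp [hd, h]
  have hdd : ∀ a, dec a = true → d a = -ρ := fun a h => by
    have : ¬ inc a = true := fun h' => hdisj a h' h
    simp [hd, h, this]
  have hdn : ∀ a, ¬ inc a = true → ¬ dec a = true → d a = 0 := fun a h₁ h₂ => by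
    simp [hd, h₁, h₂]
  have hd_le_one : ∀ a, d a ≤ 1 := fun a => by
    rw [hd]
    dsimp only
    split_ifs <;> linarith
  have hd_nonpos : ∀ a, ¬ inc a = true → d a ≤ 0 := fun a h => by
    by_cases h' : dec a = true
    · rw [hdd a h']; linarith
    · exact (hdn a h h').le
  have hedec : ∀ a c, 0 ≤ envy V occ r a c → dec c = true → dec a = true := by
    intro a c h hc
    obtain ⟨j, hj, hr⟩ := (hdec c).1 hc
    exact (hdec a).2 ⟨j, hj, .head (decide_eq_true h) hr⟩
  have heinc : ∀ a c, 0 ≤ envy V occ r a c → inc a = true → inc c = true := by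
    intro a c h ha
    rw [hinc] at ha ⊢
    rintro ⟨j, hj, hr⟩
    exact ha ⟨j, hj, .head (decide_eq_true h) hr⟩
  have hmono : ∀ a c, 0 ≤ envy V occ r a c → d a ≤ d c := by
    intro a c h
    by_cases hc : inc c = true
    · rw [hdi c hc]; exact hd_le_one a
    by_cases hc' : dec c = true
    · rw [hdd c hc', hdd a (hedec a c h hc')]
    · rw [hdn c hc hc']
      exact hd_nonpos a fun ha => hc (heinc a c h ha)
  have hdj₀ := hdd j₀ hdecj₀
  -- The room `j₀` above its bound falls towards it, so a hit time exists.
  obtain ⟨t, rfl, -, hhit, htmin⟩ := ht.exists_eq_some (i := Sum.inr j₀)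
    (hitTime_eq_some.2 ⟨by rw [hdj₀]; linarith,
      div_pos_of_neg_of_neg (by linarith) (by rw [hdj₀]; linarith), rfl⟩)
  have ht0 : 0 < t := by
    obtain ⟨_ | _, h⟩ := hhit <;> exact hitTime_pos h
  rw [Option.getD_some]
  set r' : Room n → ℝ := fun a => r a + t * d a with hr'
  have henvy : ∀ a c, envy V occ r' a c = envy V occ r a c - t * (d c - d a) :=
    envy_add_mul V occ r d t
  refine ⟨fun a c => ?_, ?_, ?_⟩
  · rw [henvy]
    rcases (hEF a c).lt_or_eq with h | h
    · exact nonpos_of_le_hitTime (htmin (Sum.inl (a, c))) ht0.le h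
    · rw [h]
      nlinarith [hmono a c h.ge]
  · rw [Finset.sum_add_distrib, ← Finset.mul_sum, hsum, mul_zero, add_zero]
  have hsubset : (Finset.univ.filter fun j => u j < r' j) ⊆
      Finset.univ.filter fun j => u j < r j := by
    intro j hj
    simp only [Finset.mem_filter, Finset.mem_univ, true_and] at hj ⊢
    by_contra hn
    rcases (not_lt.1 hn).lt_or_eq with h | h
    · have := nonneg_of_le_hitTime (htmin (Sum.inr j)) ht0.le (sub_pos.2 h)
      simp only [hr'] at hj
      linarith
    · have : ¬ inc j = true := fun hi => (hinc j).1 hi ⟨j, h.ge, .refl⟩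
      have := hd_nonpos j this
      simp only [hr'] at hj
      nlinarith
  by_cases hlt : numAbove u r' < numAbove u r
  · have h₁ := Nat.mul_le_mul_right (2 * n + 1) (Nat.succ_le_of_lt hlt)
    rw [Nat.succ_mul] at h₁
    unfold boundsPotential
    omega
  have hsame := Finset.eq_of_subset_of_card_le hsubset (not_lt.1 hlt)
  have hU : ∀ j, u j < r j → u j < r' j := by
    intro j hj
    have := congrArg (fun s => j ∈ s) hsame
    simp only [Finset.mem_filter, Finset.mem_univ, true_and] at this
    rwa [this]
  have hkeep : ∀ a c, weakEnvy V occ r a c = true → d a = d c → weakEnvy V occ r' a c = true := by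
    intro a c h hd
    simpa [henvy, hd] using h
  have hA : ∀ a, ReachesAbove V occ u r a → ReachesAbove V occ u r' a := by
    rintro a ⟨c, hc, hr⟩
    refine ⟨c, hU c hc, ?_⟩
    induction hr using Relation.ReflTransGen.head_induction_on with
    | refl => exact .refl
    | head h h' ih =>
      have h₁ := (hdec _).2 ⟨c, hc, h'⟩
      have h₂ := hedec _ _ (of_decide_eq_true h) h₁
      exact .head (hkeep _ _ h ((hdd _ h₂).trans (hdd _ h₁).symm)) ih
  -- Rooms that reach a bound but nothing above have rate `0`, so those at their bound stay there
  -- and the edges among them survive.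
  have hB : ∀ a, ReachesBound V occ u r a → ReachesBound V occ u r' a := by
    rintro a ⟨c, hc, hr⟩
    induction hr using Relation.ReflTransGen.head_induction_on with
    | refl =>
      rcases hc.lt_or_eq with h | h
      · exact ⟨c, (hU c h).le, .refl⟩
      by_cases hcd : dec c = true
      · exact (hA c ((hdec c).1 hcd)).reachesBound
      have hci : ¬ inc c = true := fun hi => (hinc c).1 hi ⟨c, hc, .refl⟩
      refine ⟨c, ?_, .refl⟩
      simp [hr', hdn c hci hcd, h]
    | @head b b' h h' ih =>
      by_cases hbd : dec b = true
      · exact (hA b ((hdec b).1 hbd)).reachesBound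
      have hb'd : ¬ dec b' = true := fun h₁ => hbd (hedec _ _ (of_decide_eq_true h) h₁)
      have hb'i : ¬ inc b' = true := fun hi => (hinc b').1 hi ⟨c, hc, h'⟩
      have hbi : ¬ inc b = true := fun hi => hb'i (heinc _ _ (of_decide_eq_true h) hi)
      obtain ⟨j, hj, hr⟩ := ih
      exact ⟨j, hj, .head (hkeep _ _ h ((hdn _ hbi hbd).trans (hdn _ hb'i hb'd).symm)) hr⟩
  have hlt : boundsReachCount V occ u r < boundsReachCount V occ u r' := by
    refine boundsReachCount_lt hA hB ?_
    obtain ⟨⟨a, c⟩ | j, hhit⟩ := hhit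
    · have hhit : hitTime (envy V occ r a c) (d c - d a) = some t := hhit
      have hneg := lt_of_le_of_ne (hEF a c) (hitTime_gap_ne hhit)
      have hrate := hitTime_rate_neg hhit hneg
      have hnew : weakEnvy V occ r' a c = true :=
        decide_eq_true ((henvy a c).trans (hitTime_hit hhit)).ge
      by_cases hci : inc c = true
      · rw [hdi c hci] at hrate
        linarith [hd_le_one a]
      by_cases hcd : dec c = true
      · obtain ⟨j, hj, hr⟩ := hA c ((hdec c).1 hcd)
        refine ⟨a, Or.inl ⟨⟨j, hj, .head hnew hr⟩, fun ha => ?_⟩⟩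
        rw [hdd c hcd, hdd a ((hdec a).2 ha)] at hrate
        linarith
      · rw [hdn c hci hcd] at hrate
        have hai : inc a = true := by
          by_contra hai
          linarith [hd_nonpos a hai]
        have hcB : ReachesBound V occ u r c := not_not.1 fun h => hci ((hinc c).2 h)
        obtain ⟨j, hj, hr⟩ := hB c hcB
        exact ⟨a, Or.inr ⟨⟨j, hj, .head hnew hr⟩, (hinc a).1 hai⟩⟩
    · have hhit : hitTime (u j - r j) (d j) = some t := hhit
      have hr'j : r' j = u j := by
        have := hitTime_hit hhit
        simp only [hr']
        linarith
      rcases lt_or_gt_of_ne (hitTime_gap_ne hhit) with h | h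
      -- A room that comes down to its bound would lower `numAbove`.
      · exact absurd (hU j (sub_neg.1 h)) (by rw [hr'j]; exact lt_irrefl _)
      · have hrate := hitTime_rate_pos hhit h
        have hji : inc j = true := by
          by_contra hji
          linarith [hd_nonpos j hji]
        exact ⟨j, Or.inr ⟨⟨j, hr'j.ge, .refl⟩, (hinc j).1 hji⟩⟩
  have h₁ := boundsReachCount_le V occ u r'
  have h₂ : numAbove u r' ≤ numAbove u r := Finset.card_le_card hsubset
  have h₃ := Nat.mul_le_mul_right (2 * n + 1) h₂
  unfold boundsPotential
  omega

/-- On a path from `a` to a room `c` with `s c ≤ u c ≤ r c`, monotonicity of `s - r` gives `s a ≤ r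
a`. The inequality is strict at a room above its bound. -/
theorem sum_lt_of_reachesBound (hB : ∀ a, ReachesBound V occ u r a) (habove : ∃ j, u j < r j)
    {s : Room n → ℝ} (hs : ∀ a c, envy V occ s a c ≤ 0) (hu : ∀ j, s j ≤ u j) :
    ∑ j, s j < ∑ j, r j := by
  obtain ⟨j, hj⟩ := habove
  refine Finset.sum_lt_sum (fun a _ => ?_) ⟨j, Finset.mem_univ _, (hu j).trans_lt hj⟩
  obtain ⟨c, hc, hr⟩ := hB a
  have := sub_le_sub_of_reach hs hr
  linarith [hu c]

end Bounds

def boundsBodyCost {R : Type} [CommSemiring R] (x : R) : R :=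
  x * 2 + (x * 2 + (x * 2 + (x * 2 + ((x * 3 + 1) + ((x * 3 + 1) +
    (x * (x * 2 + 1) + (reachCost x + (x * 2 + (x * 2 + (reachSetCost x + (reachSetCost x +
      ((x * 3 + 1) + ((x * 3 + 1) + (x * 2 + (reachSetCost x + ((x * 3 + 1) + ((x * 3 + 1) +
        ((x * 2 + (x * 2 + x * 2)) + (x * (x * 3 + 2) + (x * 3 + (x * 3 + (1 +
          (x * 2 + 0)))))))))))))))))))))))

def boundsCost {R : Type} [CommSemiring R] (x : R) : R :=
  (x * (2 * x + 1) + 2 * x + 1) * (boundsBodyCost x + 1)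

/-- The bounds algorithm without lower bounds. -/
theorem boundsAwareEFRents_spec {n : ℕ} (V : Agent n → Room n → ℝ) (occ : Room n → Agent n)
    (r u : Room n → ℝ) (hEF : ∀ a c, envy V occ r a c ≤ 0) :
    (boundsAwareEFRents V occ r (fun _ => none) u).Spec (boundsCost n) fun o =>
      (∀ r', o = some r' → (∀ a c, envy V occ r' a c ≤ 0) ∧ ∑ j, r' j = ∑ j, r j ∧
        ∀ j, r' j ≤ u j) ∧
      (o = none → ∀ s : Room n → ℝ, (∀ a c, envy V occ s a c ≤ 0) → (∀ j, s j ≤ u j) →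
        ∑ j, s j < ∑ j, r j) := by
  unfold boundsAwareEFRents
  refine whileLoop_spec (fun q => (∀ a c, envy V occ q a c ≤ 0) ∧ ∑ j, q j = ∑ j, r j)
    (boundsPotential V occ u) (T := boundsBodyCost n) ?_ ⟨hEF, rfl⟩ (boundsPotential_le V occ u r)
  rintro q ⟨hq, hsum⟩
  rw [← hsum]
  refine Timed.Spec.bind (P := (· = fun _ => false)) (tabulate_op_spec _) ?_
  rintro _ rfl
  refine Timed.Spec.bind (P := (· = fun _ => false)) (tabulate_op_spec _) ?_
  rintro _ rfl
  refine (tabulate_op_spec _).bind ?_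
  rintro _ rfl
  refine (tabulate_op_spec _).bind ?_
  rintro _ rfl
  refine (existsIndex_op_spec _).bind fun anyLow hLow => ?_
  obtain rfl : anyLow = false := by simpa using hLow
  refine (existsIndex_op_spec _).bind fun anyHigh hHigh => ?_
  cases anyHigh with
  | false =>
    refine (Timed.Spec.pure ?_).mono (Nat.zero_le _) fun _ h => h
    refine ⟨by simp, fun o ho => ?_⟩
    obtain rfl := Sum.inr.inj ho
    refine ⟨fun r' hr' => ?_, by simp⟩
    obtain rfl := Option.some.inj hr'
    refine ⟨hq, rfl, fun j => ?_⟩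
    by_contra hj
    simpa using hHigh.2 ⟨j, by simpa using hj⟩
  | true =>
    have habove : ∃ j, u j < q j := by simpa using hHigh
    rw [if_neg (by simp)]
    refine (envyGraph_spec _ _ _).bind ?_
    rintro _ rfl
    refine (reachability_spec _).bind fun M hM => ?_
    refine (tabulate_op_spec _).bind ?_
    rintro _ rfl
    refine (tabulate_op_spec _).bind ?_
    rintro _ rfl
    refine (reachFrom_spec _ _).bind fun fromLow hfrom => ?_
    refine (reachTo_spec _ _).bind fun toHigh hto => ?_
    refine (existsIndex_op_spec _).bind fun highBlocked hhb => ?_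
    refine (existsIndex_op_spec _).bind fun lowBlocked hlb => ?_
    obtain rfl : highBlocked = false := by
      have : ∀ c, fromLow c = false := by simpa using hfrom
      simpa [this] using hhb
    obtain rfl : lowBlocked = false := by simpa using hlb
    rw [if_neg (by simp)]
    refine (tabulate_op_spec _).bind ?_
    rintro _ rfl
    dsimp only
    rw [if_pos rfl]
    refine (reachTo_spec _ _).bind fun dec hdec => ?_
    have hdec' : ∀ a, dec a = true ↔ ReachesAbove V occ u q a := fun a => by
      simp [hdec, ReachesAbove, hM]
    have hinc : ∀ a, (!toHigh a) = true ↔ ¬ ReachesBound V occ u q a := fun a => by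
      rw [Bool.not_eq_true', ← Bool.not_eq_true, hto]
      refine not_congr (exists_congr fun c => and_congr ?_ (hM a c))
      rw [Bool.or_eq_true, decide_eq_true_eq, decide_eq_true_eq, le_iff_lt_or_eq, eq_comm (a := q c)]
    refine (existsIndex_op_spec _).bind fun anyInc hanyInc => ?_
    refine (existsIndex_op_spec _).bind fun anyDec hanyDec => ?_
    obtain rfl : anyDec = true := by
      obtain ⟨j, hj⟩ := habove
      exact hanyDec.2 ⟨j, (hdec' j).2 ⟨j, hj, .refl⟩⟩
    cases anyInc with
    | false =>
      rw [if_pos (by simp)]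
      refine (Timed.Spec.pure ?_).mono (Nat.zero_le _) fun _ h => h
      refine ⟨by simp, fun o ho => ?_⟩
      obtain rfl := Sum.inr.inj ho
      refine ⟨by simp, fun _ s hs hu => sum_lt_of_reachesBound (fun a => ?_) habove hs hu⟩
      by_contra ha
      simpa using hanyInc.2 ⟨a, (hinc a).2 ha⟩
    | true =>
      rw [if_neg (by simp)]
      refine (ratesUnitUp_spec _ _).bind fun d hd => ?_
      refine (nextWeakEdge_spec _ _ _ _).bind fun t₁ ht₁ => ?_
      refine (minimum_op_spec _).bind fun t₂ ht₂ => ?_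
      refine (minimum_op_spec _).bind fun t₃ ht₃ => ?_
      -- There are no lower bounds to hit.
      obtain rfl : t₃ = none := by
        cases t₃ with
        | none => rfl
        | some s =>
          obtain ⟨_, h⟩ := ht₃.2 s rfl
          cases h
      refine (op_spec _).bind ?_
      rintro _ rfl
      refine (advance_spec _ _ _).bind ?_
      rintro _ rfl
      refine Timed.Spec.pure ⟨fun s' hs' => ?_, by simp⟩
      obtain rfl := Sum.inl.inj hs'
      have hmin : minOption t₂ none = t₂ := by cases t₂ <;> rfl
      rw [hmin]
      obtain ⟨h₁, h₂, h₃⟩ := bounds_step hq hdec' hinc habove (hanyInc.1 rfl) hd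
        (ht₁.minOption ht₂)
      exact ⟨⟨h₁, h₂⟩, h₃⟩

/-! ### The main algorithm -/

section Main

variable {n : ℕ} {V b : Agent n → Room n → ℝ} {Rt : ℝ}

/-- The assignment `occ`, which comes from `occ₀` by reassignments along indifferences within the
components of the envy graph, after the components of the first `k` rooms have been treated. -/
structure IsPartialAssignment (V b : Agent n → Room n → ℝ) (Rt : ℝ) (occ₀ : Room n → Agent n)
    (r₀ : Room n → ℝ) (k : ℕ) (occ : Room n → Agent n) (π : Equiv.Perm (Room n)) : Prop where
  occ_eq : occ = occ₀ ∘ π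
  reach : ∀ a, (weakEnvy V occ₀ r₀).Reach a (π a) ∧ (weakEnvy V occ₀ r₀).Reach (π a) a
  indifferent : ∀ a, V (occ a) a - r₀ a = V (occ a) (π a) - r₀ (π a)
  untreated : ∀ a, (∀ c : Room n, c.val < k →
    ¬ ((weakEnvy V occ₀ r₀).Reach c a ∧ (weakEnvy V occ₀ r₀).Reach a c)) → π a = a
  treated : ∀ a, ∀ c : Room n, c.val < k →
    (weakEnvy V occ₀ r₀).Reach c a → (weakEnvy V occ₀ r₀).Reach a c →
    ∀ p ∈ EFb V b Rt, p.2 a ≤ b (occ a) a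

/-- `c` is the first room of its component, so no room of the component has been touched and the
component solution can be inserted. The budget claim concerns all allocations of `EFb V b Rt`
simultaneously. -/
theorem IsPartialAssignment.step {e : Room n ≃ Agent n} {r₀ r : Room n → ℝ} {c : Room n}
    {C : Room n → Bool} {occ occC : Room n → Agent n} {π ρ : Equiv.Perm (Room n)}
    (hEF : ∀ a c, envy V e r₀ a c ≤ 0)
    (h : IsPartialAssignment V b Rt e r₀ c occ π)
    (hfirst : ∀ a < c, ¬ ((weakEnvy V e r₀).Reach c a ∧ (weakEnvy V e r₀).Reach a c))
    (hC : ∀ a, C a = true ↔ (weakEnvy V e r₀).Reach c a ∧ (weakEnvy V e r₀).Reach a c)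
    (hρ : IsComponentSolution V b C e r₀ occC r ρ) {x : Room n} (hx : C x = true)
    (hstuck : ∀ c, budgetEnvy V b C occC r x c = true →
      ¬ (budgetEnvy V b C occC r).Reach c x) :
    IsPartialAssignment V b Rt e r₀ (c + 1) (fun a => if C a = true then occC a else occ a)
      (ρ.trans π) := by
  have hπ : ∀ a, C a = true → π a = a := by
    refine fun a ha => h.untreated a fun d hd hr => ?_
    obtain ⟨h₁, h₂⟩ := (hC a).1 ha
    exact hfirst d hd ⟨h₁.trans hr.2, hr.1.trans h₂⟩
  have hin : ∀ a, C a = true → π (ρ a) = ρ a := fun a ha => hπ _ (hρ.mem ha)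
  refine ⟨?_, fun a => ?_, fun a => ?_, fun a ha => ?_, fun a d hd h₁ h₂ p hp => ?_⟩
  · funext a
    by_cases ha : C a = true
    · simp [ha, hρ.occ_eq, hin a ha]
    · simp [ha, h.occ_eq, hρ.fixed a ha]
  · by_cases ha : C a = true
    · obtain ⟨h₁, h₂⟩ := (hC a).1 ha
      obtain ⟨h₃, h₄⟩ := (hC _).1 (hρ.mem ha)
      rw [Equiv.trans_apply, hin a ha]
      exact ⟨h₂.trans h₃, h₄.trans h₁⟩
    · rw [Equiv.trans_apply, hρ.fixed a ha]
      exact h.reach a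
  · by_cases ha : C a = true
    · rw [Equiv.trans_apply, hin a ha]
      simpa only [ha, if_true] using hρ.indifferent a
    · rw [Equiv.trans_apply, hρ.fixed a ha]
      simpa only [if_neg ha] using h.indifferent a
  · have haC : ¬ C a = true := fun h => ha c (Nat.lt_succ_self _) ((hC a).1 h)
    rw [Equiv.trans_apply, hρ.fixed a haC]
    exact h.untreated a fun d hd => ha d (Nat.lt_succ_of_lt hd)
  · by_cases ha : C a = true
    · simp only [ha, if_true]
      exact hρ.le_budget hEF hp.1.2 hp.2 hC hx hstuck ha
    · simp only [ha]
      rcases Nat.lt_succ_iff_lt_or_eq.1 hd with hd | hd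
      · exact h.treated a d hd h₁ h₂ p hp
      · obtain rfl : d = c := Fin.ext hd
        exact absurd ((hC a).2 ⟨h₁, h₂⟩) ha

theorem IsPartialAssignment.step_of_treated {occ₀ occ : Room n → Agent n} {r₀ : Room n → ℝ}
    {π : Equiv.Perm (Room n)} {a c : Room n}
    (h : IsPartialAssignment V b Rt occ₀ r₀ c occ π) (hac : a < c)
    (h₁ : (weakEnvy V occ₀ r₀).Reach c a) (h₂ : (weakEnvy V occ₀ r₀).Reach a c) :
    IsPartialAssignment V b Rt occ₀ r₀ (c + 1) occ π := by
  refine ⟨h.occ_eq, h.reach, h.indifferent,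
    fun d hd => h.untreated d fun f hf => hd f (Nat.lt_succ_of_lt hf), fun d f hf h₃ h₄ p hp => ?_⟩
  rcases Nat.lt_succ_iff_lt_or_eq.1 hf with hf | hf
  · exact h.treated d f hf h₃ h₄ p hp
  · obtain rfl : f = c := Fin.ext hf
    exact h.treated d a hac (h₂.trans h₃) (h₄.trans h₁) p hp

/-- The steps for one room in the loop over the components. -/
def componentCost {R : Type} [CommSemiring R] (x : R) : R :=
  (x * 3 + 1) + (x * 2 + (sccCost x + x * 2))

def mainCost {R : Type} [CommSemiring R] (x : R) : R :=
  klijnCost x + (x * (x * 2 + 1) + (reachCost x + (x * (x * 2 + 1) + (x * componentCost x +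
    (x * 2 + (x * 2 + (x * 2 + (boundsCost x + (x * 2 + 0)))))))))

/-- A returned allocation is always in `EFb V b Rt`. Conversely, the rents of any member are
envy-free for the combined assignment and bounded by `u`, so they refute the certificate behind the
answer `none`. -/
theorem budgetAwareEF_spec (hn : 0 < n) (V b : Agent n → Room n → ℝ) (Rt : ℝ) :
    (budgetAwareEF V b Rt).Spec (mainCost n) fun out =>
      ((EFb V b Rt).Nonempty → ∃ (σ : Agent n ≃ Room n) (r : Room n → ℝ),
        out = some (⇑σ, r) ∧ (σ, r) ∈ EFb V b Rt) ∧
      (EFb V b Rt = ∅ → out = none) := by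
  unfold budgetAwareEF
  refine (klijn_spec V).bind ?_
  rintro ⟨occ₀, r₀⟩ ⟨hbij, hEF⟩
  dsimp only at hbij hEF ⊢
  obtain ⟨e, rfl⟩ : ∃ e : Room n ≃ Agent n, ⇑e = occ₀ := ⟨Equiv.ofBijective _ hbij, rfl⟩
  refine (envyGraph_spec _ _ _).lift.bind ?_
  rintro _ rfl
  refine (reachability_spec _).lift.bind fun M hM => ?_
  refine (tabulate_tabulate_op_spec _).lift.bind ?_
  rintro _ rfl
  refine (Comp.foldlM_finRange_spec (T := componentCost n)
    (fun k occ => ∃ π, IsPartialAssignment V b Rt e r₀ k occ π) ?_ ?_).bind ?_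
  · rintro c occ ⟨π, hπ⟩
    refine (existsIndex_op_spec _).lift.bind fun notFirst hnf => ?_
    split_ifs with h
    · refine (Comp.Spec.pure ⟨π, ?_⟩).mono (Nat.zero_le _) fun _ h => h
      obtain ⟨a, ha⟩ := hnf.1 h
      simp only [Bool.and_eq_true, decide_eq_true_eq, hM] at ha
      exact hπ.step_of_treated ha.1 ha.2.1 ha.2.2
    · refine (tabulate_op_spec _).lift.bind ?_
      rintro C hCdef
      have hC : ∀ a, C a = true ↔
          (weakEnvy V e r₀).Reach c a ∧ (weakEnvy V e r₀).Reach a c := fun a => by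
        simp [hCdef, hM]
      refine (sccEFRents_spec V b C hEF ((hC c).2 ⟨.refl, .refl⟩)).bind ?_
      rintro ⟨_, occC, _⟩ ⟨r, ρ, hρ, x, hx, -, hstuck⟩
      refine ((tabulate_op_spec _).lift).mono le_rfl ?_
      rintro _ rfl
      refine ⟨_, hπ.step hEF (fun a hac hr => h (hnf.2 ⟨a, ?_⟩)) hC hρ hx hstuck⟩
      simpa [hM] using ⟨hac, hr⟩
  · exact ⟨Equiv.refl _, rfl, fun _ => ⟨.refl, .refl⟩, fun _ => rfl, fun _ _ => rfl,
      fun _ _ hc => absurd hc (Nat.not_lt_zero _)⟩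
  rintro occ ⟨π, hπ⟩
  have hocc : occ = π.trans e := hπ.occ_eq
  refine (sumEntries_spec _).lift.bind ?_
  rintro _ rfl
  refine (tabulate_op_spec _).lift.bind ?_
  rintro r hr
  refine (tabulate_op_spec _).lift.bind ?_
  rintro u hu
  have hrsum : ∑ j, r j = Rt := by
    have : (n : ℝ) ≠ 0 := by exact_mod_cast hn.ne'
    rw [hr, Finset.sum_add_distrib, Finset.sum_const, Finset.card_fin, nsmul_eq_mul]
    field_simp
    ring
  have hrEF : ∀ a c, envy V occ r a c ≤ 0 := by
    intro a c
    have h₁ := hEF (π a) c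
    have h₂ := hπ.indifferent a
    rw [hocc] at h₂ ⊢
    simp only [Equiv.trans_apply] at h₂
    simp only [envy, hr, Equiv.trans_apply] at h₁ ⊢
    linarith
  -- `a` and `π a` lie in the same component, so the change from `r₀` to `p.2` is the same on both
  -- and preserves the agent's indifference.
  have hwit : ∀ p ∈ EFb V b Rt, (∀ a c, envy V occ p.2 a c ≤ 0) ∧ ∀ j, p.2 j ≤ u j := by
    intro p hp
    have hs := envy_nonpos_of_envyFree hEF hp.1.2
    refine ⟨fun a c => ?_, fun j => ?_⟩
    · have h₁ := hs (π a) c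
      have h₂ := hπ.indifferent a
      have h₃ := sub_le_sub_of_reach hs (hπ.reach a).1
      have h₄ := sub_le_sub_of_reach hs (hπ.reach a).2
      rw [hocc] at h₂ ⊢
      simp only [Equiv.trans_apply] at h₂
      simp only [envy, Equiv.trans_apply] at h₁ ⊢
      linarith
    · rw [hu]
      exact hπ.treated j j j.is_lt .refl .refl p hp
  refine (boundsAwareEFRents_spec V occ r u hrEF).bind ?_
  rintro (_ | r') ⟨hsome, hnone⟩
  · refine (Comp.Spec.pure ?_).mono (Nat.zero_le _) fun _ h => h
    refine ⟨fun ⟨p, hp⟩ => ?_, fun _ => rfl⟩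
    have := hnone rfl p.2 (hwit p hp).1 (hwit p hp).2
    rw [hrsum, hp.1.1] at this
    exact absurd this (lt_irrefl _)
  · obtain ⟨h₁, h₂, h₃⟩ := hsome r' rfl
    -- Inverting the array of occupants: by injectivity, no later write overwrites an earlier one.
    refine (forLoop_spec (T := 1) (fun k s => ∀ j : Fin n, j.val < k → s (occ j) = j)
      ?_ (by simp)).lift.bind ?_
    · intro i s hs
      refine op_spec' fun j hj => ?_
      rcases Nat.lt_succ_iff_lt_or_eq.1 hj with hj | hj
      · rw [Function.update_of_ne, hs j hj]
        rw [hocc]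
        exact fun h => hj.ne (congrArg Fin.val ((π.trans e).injective h))
      · obtain rfl : j = i := Fin.ext hj
        simp
    · intro room hroom
      have hinv : room = (π.trans e).symm := by
        funext i
        obtain ⟨j, rfl⟩ := (π.trans e).surjective i
        rw [Equiv.symm_apply_apply, ← hocc]
        exact hroom j j.is_lt
      have hmem : ((π.trans e).symm, r') ∈ EFb V b Rt := by
        refine ⟨⟨h₂.trans hrsum, fun i j => ?_⟩, fun i => ?_⟩
        · have := h₁ ((π.trans e).symm i) j
          rw [hocc] at this
          unfold envy at this
          rw [Equiv.apply_symm_apply] at this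
          linarith
        · have := h₃ ((π.trans e).symm i)
          rw [hu] at this
          simp only [hocc, Equiv.apply_symm_apply] at this
          exact this
      refine Comp.Spec.pure ⟨fun _ => ⟨_, r', by rw [hinv], hmem⟩, fun hempty => ?_⟩
      rw [hempty] at hmem
      exact absurd hmem (Set.notMem_empty _)

end Main

end RentDivision
end

theorem mainTheorem2 :
    ∃ P : Polynomial ℕ, ∀ n : ℕ, 0 < n →
      ∀ (V b : RentDivision.Agent n → RentDivision.Room n → ℝ) (Rt : ℝ),
        ∃ (out : Option ((RentDivision.Agent n → RentDivision.Room n) ×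
            (RentDivision.Room n → ℝ))) (t : ℕ),
          (RentDivision.budgetAwareEF V b Rt).HaltsIn out t ∧
          t ≤ P.eval n ∧
          ((RentDivision.EFb V b Rt).Nonempty →
            ∃ (σ : RentDivision.Agent n ≃ RentDivision.Room n) (r : RentDivision.Room n → ℝ),
              out = some (⇑σ, r) ∧ (σ, r) ∈ RentDivision.EFb V b Rt) ∧
          (RentDivision.EFb V b Rt = ∅ → out = none) := by
  -- The cost expression evaluated at the indeterminate is the required polynomial.
  refine ⟨RentDivision.mainCost Polynomial.X, fun n hn V b Rt => ?_⟩
  obtain ⟨out, t, h, ht, hout⟩ := RentDivision.budgetAwareEF_spec hn V b Rt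
  refine ⟨out, t, h, ht.trans (le_of_eq ?_), hout⟩
  simp [RentDivision.mainCost, RentDivision.klijnCost, RentDivision.klijnBodyCost,
    RentDivision.reachCost, RentDivision.reshuffleCost, RentDivision.nextTowardsCost,
    RentDivision.componentCost, RentDivision.sccCost, RentDivision.sccBodyCost,
    RentDivision.boundsCost, RentDivision.boundsBodyCost, RentDivision.reachSetCost]
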